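/- Let $\Bbbk$ be a field. All algebras, coalgebras and maps are $\Bbbk$-linear, and Sweedler notation $\Delta(x)=x_1\otimes x_2$ is used. A \emph{Yetter--Drinfeld (YD) post-Hopf algebra} $(H,\cdot,1,\Delta,\epsilon,S,\rightharpoonup)$ consists of an algebra $(H,\cdot,1)$, a coalgebra $(H,\Delta,\epsilon)$, a linear map $S:H\to H$ with $x_1\cdot S(x_2)=S(x_1)\cdot x_2=\epsilon(x)1$, and a coalgebra morphism $\rightharpoonup:H\otimes H\to H$ such that $$x\rightharpoonup(y\cdot z)=(x_1\rightharpoonup y)\cdot(x_2\rightharpoonup z),\qquad x\rightharpoonup(y\rightharpoonup z)=\big(x_1\cdot(x_2\rightharpoonup y)\big)\rightharpoonup z,$$ the map $\alpha:H\to\mathrm{End}(H)$, $\alpha x(y)=x\rightharpoonup y$, has a convolution inverse $\beta$, $\epsilon$ is an algebra morphism, $\Delta(1)=1\otimes 1$, $\Delta(x\cdot y)=\big(x_1\cdot\alpha x_2(\beta x_4(y_1))\big)\otimes(x_3\cdot y_2)$, and, setting $x\bullet y:=x_1\cdot(x_2\rightharpoonup y)$, $S_\rightharpoonup(x):=\beta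 x_1(S(x_2))$ and $x\leftharpoonup y:=S_\rightharpoonup(x_1\rightharpoonup y_1)\bullet x_2\bullet y_2$, one has $\Delta S_\rightharpoonup(x)=S_\rightharpoonup(x_2)\otimes S_\rightharpoonup(x_1)$ and $(x_1\rightharpoonup y_1)\otimes(x_2\leftharpoonup y_2)=(x_2\rightharpoonup y_2)\otimes(x_1\leftharpoonup y_1)$. Morphisms are the algebra and coalgebra morphisms $g$ with $g(x\rightharpoonup y)=g(x)\rightharpoonup' g(y)$. Write $\mathcal{YD}\mathrm{PH}$ for this category and $H_\rightharpoonup:=(H,\bullet,1,\Delta,\epsilon,S_\rightharpoonup)$. A \emph{YD relative Rota--Baxter operator} is a bijective coalgebra morphism $R:K\to H$, where $H$ is a Hopf algebra with antipode $S_H$ and $K$ is a bimonoid in the braided category ${}^H_H\mathcal{YD}$ of left-left Yetter--Drinfeld modules with action $\rightharpoonup$, such that for all $a,b\in K$ $$R(a)R(b)=R\big(a_1(R(a_2)\rightharpoonup b)\big),$$ $$S_HR(R(a_1)\rightharpoonup b_1)R(a_2)R(b_2)\otimes R(R(a_3)\rightharpoonup b_3)=S_HR(R(a_2)\rightharpoonup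 b_2)R(a_3)R(b_3)\otimes R(R(a_1)\rightharpoonup b_1),$$ and $(a_1\rightharpoonup R^{-1}S_H(a_2))R^{-1}(a_3)=\epsilon(a)1_K$ for all $a\in H$. A morphism from $R:K\to H$ to $R':K'\to H'$ is a pair of algebra and coalgebra morphisms $(f:H\to H',\,g:K\to K')$ with $fR=R'g$ and $g(a\rightharpoonup x)=f(a)\rightharpoonup' g(x)$. Let $\mathcal D$ be the full subcategory of those $R:K\to H$ for which the $H$-coaction on $K$ is $(\mathrm{Id}_H\otimes R^{-1})\mathrm{Ad}_L R$, where $\mathrm{Ad}_L(a)=a_1S_H(a_3)\otimes a_2$. Then: (1) There is a functor $L:\mathcal{YD}\mathrm{PH}\to\mathcal D$ sending $(H,\rightharpoonup)$ to $\mathrm{Id}_H:H\to H_\rightharpoonup$ (where $H_\rightharpoonup$ acts on $H$ by $\rightharpoonup$ and $H$ has the coaction $\mathrm{Ad}_L$ of $H_\rightharpoonup$) and $g$ to $(g,g)$, and there is a functor $M:\mathcal D\to\mathcal{YD}\mathrm{PH}$ sending $R:K\to H$ to $(H,\cdot_R,1,\Delta,\epsilon,S_R,\rightharpoonup_R)$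 with $$a\cdot_R b=R(R^{-1}(a)R^{-1}(b)),\qquad S_R(a)=R(a_1\rightharpoonup R^{-1}S_H(a_2)),\qquad a\rightharpoonup_R b=R(a\rightharpoonup R^{-1}(b)),$$ and $(f,g)$ to $f$. The functors $L$ and $M$ are mutually quasi-inverse equivalences; in particular $\mathcal{YD}\mathrm{PH}$ and $\mathcal D$ are equivalent. (2) Call $(H,\cdot,1,\Delta,\epsilon,S,\rightharpoonup)$ a \emph{cocommutative post-Hopf algebra} if $(H,\cdot,1,\Delta,\epsilon,S)$ is an ordinary cocommutative Hopf algebra, $\rightharpoonup$ is a coalgebra morphism satisfying the two displayed identities for $x\rightharpoonup(y\cdot z)$ and $x\rightharpoonup(y\rightharpoonup z)$, and $\alpha$ is convolution invertible. Call a bijective coalgebra morphism $R:K\to H$ between ordinary cocommutative Hopf algebras, where $K$ is an $H$-module bialgebra, a \emph{bijective relative Rota--Baxter operator} if $R(a)R(b)=R(a_1(R(a_2)\rightharpoonup b))$ for all $a,b\in K$. Morphisms are defined as above. Cocommutative post-Hopf algebras are exactly the cocommutative YD post-Hopf algebras. Bijective relative Rota--Baxter operators on cocommutative Hopf algebras,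 with $K$ given the trivial coaction $x\mapsto 1\otimes x$, are exactly the objects $R:K\to H$ of $\mathcal D$ with $H$ cocommutative. The equivalence given by $L$ and $M$ restricts to an equivalence between the category of cocommutative post-Hopf algebras and the category of bijective relative Rota--Baxter operators on cocommutative Hopf algebras. -/

import Mathlib

open CategoryTheory
open scoped TensorProduct

universe u v

namespace YDPH

/-! ### Sweedler sums -/

section Sweedler

variable {k : Type*} [Field k]
variable {V W U : Type*} [AddCommGroup V] [Module k V] [AddCommGroup W] [Module k W]
  [AddCommGroup U] [Module k U]

/-- The Sweedler sum `∑ f vᵢ wᵢ` where `t = ∑ vᵢ ⊗ wᵢ`. It is computed on one chosen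
decomposition of `t`. It is only used for bilinear `f`, and then it does not depend on the
decomposition (`sw_eq_lift`). -/
noncomputable def sw (t : V ⊗[k] W) (f : V → W → U) : U :=
  ∑ i ∈ (TensorProduct.exists_finset t).choose, f i.1 i.2

theorem sw_eq_lift (t : V ⊗[k] W) (F : V →ₗ[k] W →ₗ[k] U) :
    sw t (fun x y => F x y) = TensorProduct.lift F t := by
  conv_rhs => rw [(TensorProduct.exists_finset t).choose_spec]
  simp [sw]

variable [Coalgebra k V]

variable (k) in
/-- `∑ f a₁ a₂`, where `Δ(a) = ∑ a₁ ⊗ a₂`. -/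
noncomputable def sw₂ (a : V) (f : V → V → U) : U :=
  sw (Coalgebra.comul (R := k) a) f

variable (k) in
/-- `∑ f a₁ a₂ a₃`. -/
noncomputable def sw₃ (a : V) (f : V → V → V → U) : U :=
  sw₂ k a fun a₁ a' => sw₂ k a' fun a₂ a₃ => f a₁ a₂ a₃

variable (k) in
/-- `∑ f a₁ a₂ a₃ a₄`. -/
noncomputable def sw₄ (a : V) (f : V → V → V → V → U) : U :=
  sw₂ k a fun a₁ a' => sw₃ k a' fun a₂ a₃ a₄ => f a₁ a₂ a₃ a₄

end Sweedler

/-! ### Algebras and Hopf algebras with explicit structure maps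

Several products live on one and the same coalgebra, so products, units and antipodes are
explicit linear maps. The coalgebra structure is Mathlib's. -/

section Algebraic

variable {k : Type*} [Field k] {V : Type*} [AddCommGroup V] [Module k V]

/-- `(V, mul, one)` is an associative unital `k`-algebra. -/
structure IsAlg (mul : V →ₗ[k] V →ₗ[k] V) (one : V) : Prop where
  mul_assoc : ∀ x y z, mul (mul x y) z = mul x (mul y z)
  one_mul : ∀ x, mul one x = x
  mul_one : ∀ x, mul x one = x

variable [Coalgebra k V]

/-- `S` is a convolution inverse of the identity. -/
structure IsAntipode (mul : V →ₗ[k] V →ₗ[k] V) (one : V) (S : V →ₗ[k] V) : Prop where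
  mul_S : ∀ x, (sw₂ k x fun x₁ x₂ => mul x₁ (S x₂)) = Coalgebra.counit (R := k) x • one
  S_mul : ∀ x, (sw₂ k x fun x₁ x₂ => mul (S x₁) x₂) = Coalgebra.counit (R := k) x • one

/-- `(V, mul, one, Δ, ε, S)` is a Hopf algebra over `k`. -/
structure IsHopf (mul : V →ₗ[k] V →ₗ[k] V) (one : V) (S : V →ₗ[k] V) : Prop extends
    IsAlg mul one, IsAntipode mul one S where
  comul_mul : ∀ x y, Coalgebra.comul (R := k) (mul x y) =
    sw₂ k x fun x₁ x₂ => sw₂ k y fun y₁ y₂ => mul x₁ y₁ ⊗ₜ[k] mul x₂ y₂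
  comul_one : Coalgebra.comul (R := k) one = one ⊗ₜ[k] one
  counit_mul : ∀ x y, Coalgebra.counit (R := k) (mul x y) =
    Coalgebra.counit (R := k) x * Coalgebra.counit (R := k) y
  counit_one : Coalgebra.counit (R := k) one = 1

/-- The left adjoint coaction `a ↦ a₁ S(a₃) ⊗ a₂` of a Hopf algebra on itself. -/
noncomputable def adL (mul : V →ₗ[k] V →ₗ[k] V) (S : V →ₗ[k] V) : V →ₗ[k] V ⊗[k] V :=
  (TensorProduct.lift (mul.compl₂ S)).rTensor V ∘ₗ
    (TensorProduct.assoc k V V V).symm.toLinearMap ∘ₗ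
    ((TensorProduct.comm k V V).toLinearMap ∘ₗ Coalgebra.comul).lTensor V ∘ₗ
    Coalgebra.comul

variable {H K : Type*} [AddCommGroup H] [Module k H] [Coalgebra k H]
  [AddCommGroup K] [Module k K] [Coalgebra k K]

/-- `K` is a module algebra and a module coalgebra over `(H, mulH, oneH, Δ, ε)`: a left module
whose product, unit, coproduct and counit are `H`-linear. -/
structure IsModuleAlgCoalg (mulH : H →ₗ[k] H →ₗ[k] H) (oneH : H)
    (mulK : K →ₗ[k] K →ₗ[k] K) (oneK : K) (act : H →ₗ[k] K →ₗ[k] K) : Prop where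
  one_act : ∀ x, act oneH x = x
  mul_act : ∀ a b x, act (mulH a b) x = act a (act b x)
  act_mul : ∀ a x y, act a (mulK x y) = sw₂ k a fun a₁ a₂ => mulK (act a₁ x) (act a₂ y)
  act_one : ∀ a, act a oneK = Coalgebra.counit (R := k) a • oneK
  comul_act : ∀ a x, Coalgebra.comul (R := k) (act a x) =
    sw₂ k a fun a₁ a₂ => sw₂ k x fun x₁ x₂ => act a₁ x₁ ⊗ₜ[k] act a₂ x₂
  counit_act : ∀ a x, Coalgebra.counit (R := k) (act a x) =
    Coalgebra.counit (R := k) a * Coalgebra.counit (R := k) x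

/-- `K` is a bimonoid in the braided monoidal category of left-left Yetter-Drinfeld modules over
the Hopf algebra `H`, with action `a ⇀ x = act a x`, coaction `x ↦ x' ⊗ x₀` and braiding
`x ⊗ y ↦ (x' ⇀ y) ⊗ x₀`. -/
structure IsYDBimonoid (mulH : H →ₗ[k] H →ₗ[k] H) (oneH : H) (SH : H →ₗ[k] H)
    (mulK : K →ₗ[k] K →ₗ[k] K) (oneK : K) (act : H →ₗ[k] K →ₗ[k] K)
    (coact : K →ₗ[k] H ⊗[k] K) : Prop extends
    IsAlg mulK oneK, IsModuleAlgCoalg mulH oneH mulK oneK act where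
  coact_coassoc : ∀ x, TensorProduct.assoc k H H K
    ((Coalgebra.comul (R := k) (A := H)).rTensor K (coact x)) = coact.lTensor H (coact x)
  coact_counit : ∀ x, (sw (coact x) fun x' x₀ => Coalgebra.counit (R := k) x' • x₀) = x
  /-- compatibility of action and coaction:
  `(a ⇀ x)' ⊗ (a ⇀ x)₀ = a₁ x' S(a₃) ⊗ (a₂ ⇀ x₀)` -/
  coact_act : ∀ a x, coact (act a x) =
    sw₃ k a fun a₁ a₂ a₃ => sw (coact x) fun x' x₀ =>
      mulH (mulH a₁ x') (SH a₃) ⊗ₜ[k] act a₂ x₀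
  /-- the product is colinear -/
  coact_mul : ∀ x y, coact (mulK x y) =
    sw (coact x) fun x' x₀ => sw (coact y) fun y' y₀ => mulH x' y' ⊗ₜ[k] mulK x₀ y₀
  /-- the unit is colinear -/
  coact_one : coact oneK = oneH ⊗ₜ[k] oneK
  /-- the coproduct is colinear -/
  coact_comul : ∀ x, (Coalgebra.comul (R := k) (A := K)).lTensor H (coact x) =
    sw₂ k x fun x₁ x₂ => sw (coact x₁) fun x₁' x₁₀ => sw (coact x₂) fun x₂' x₂₀ =>
      mulH x₁' x₂' ⊗ₜ[k] (x₁₀ ⊗ₜ[k] x₂₀)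
  /-- the counit is colinear -/
  coact_counit_colinear : ∀ x, (sw (coact x) fun x' x₀ => Coalgebra.counit (R := k) x₀ • x') =
    Coalgebra.counit (R := k) x • oneH
  /-- `Δ(x y) = x₁ (x₂' ⇀ y₁) ⊗ x₂₀ y₂` -/
  comul_mul : ∀ x y, Coalgebra.comul (R := k) (mulK x y) =
    sw₂ k x fun x₁ x₂ => sw₂ k y fun y₁ y₂ => sw (coact x₂) fun x₂' x₂₀ =>
      mulK x₁ (act x₂' y₁) ⊗ₜ[k] mulK x₂₀ y₂
  comul_one : Coalgebra.comul (R := k) oneK = oneK ⊗ₜ[k] oneK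
  counit_mul : ∀ x y, Coalgebra.counit (R := k) (mulK x y) =
    Coalgebra.counit (R := k) x * Coalgebra.counit (R := k) y
  counit_one : Coalgebra.counit (R := k) oneK = 1

end Algebraic

/-! ### Yetter-Drinfeld post-Hopf algebras -/

/-- The raw data `(H, ·, 1, Δ, ε, S, ⇀)`. Only the coalgebra axioms are imposed here. -/
structure PHData (k : Type u) [Field k] where
  H : Type v
  [addCommGroup : AddCommGroup H]
  [module : Module k H]
  [coalgebra : Coalgebra k H]
  mul : H →ₗ[k] H →ₗ[k] H
  one : H
  S : H →ₗ[k] H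
  act : H →ₗ[k] H →ₗ[k] H

attribute [instance] PHData.addCommGroup PHData.module PHData.coalgebra

namespace PHData

variable {k : Type u} [Field k] (A : PHData.{u, v} k)

/-- `α : H → End(H)`, `α x y = x ⇀ y`, as an element of the convolution algebra
`Hom(H, End(H))`. -/
def α : WithConv (A.H →ₗ[k] Module.End k A.H) := WithConv.toConv A.act

/-- The convolution inverse `β : H → End(H)` of `α` (zero if `α` is not invertible). -/
noncomputable def β : A.H →ₗ[k] Module.End k A.H := (Ring.inverse A.α).ofConv

/-- `x • y = x₁ · (x₂ ⇀ y)`. -/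
noncomputable def bullet : A.H →ₗ[k] A.H →ₗ[k] A.H :=
  TensorProduct.lift ((LinearMap.mul k (Module.End k A.H)).compl₁₂ A.mul A.act) ∘ₗ
    Coalgebra.comul

theorem bullet_apply (x y : A.H) :
    A.bullet x y = sw₂ k x fun x₁ x₂ => A.mul x₁ (A.act x₂ y) := by
  have h : ∀ t : A.H ⊗[k] A.H,
      TensorProduct.lift ((LinearMap.mul k (Module.End k A.H)).compl₁₂ A.mul A.act) t y =
        TensorProduct.lift (A.mul.compl₂ (A.act.flip y)) t := by
    intro t
    induction t with
    | zero => simp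
    | tmul a b => simp
    | add a b ha hb => simp only [map_add, LinearMap.add_apply, ha, hb]
  exact (h _).trans (sw_eq_lift _ (A.mul.compl₂ (A.act.flip y))).symm

/-- `S_⇀(x) = β x₁ (S x₂)`. -/
noncomputable def subS : A.H →ₗ[k] A.H :=
  TensorProduct.lift (A.β.compl₂ A.S) ∘ₗ Coalgebra.comul

theorem subS_apply (x : A.H) : A.subS x = sw₂ k x fun x₁ x₂ => A.β x₁ (A.S x₂) :=
  (sw_eq_lift (Coalgebra.comul (R := k) x) (A.β.compl₂ A.S)).symm

/-- `x ↼ y = S_⇀(x₁ ⇀ y₁) • x₂ • y₂`. -/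
noncomputable def ract (x y : A.H) : A.H :=
  sw₂ k x fun x₁ x₂ => sw₂ k y fun y₁ y₂ =>
    A.bullet (A.bullet (A.subS (A.act x₁ y₁)) x₂) y₂

/-- Morphisms: coalgebra and algebra maps compatible with `⇀`. -/
@[ext]
structure Hom (A B : PHData.{u, v} k) where
  g : A.H →ₗc[k] B.H
  map_mul : ∀ x y, g (A.mul x y) = B.mul (g x) (g y)
  map_one : g A.one = B.one
  map_act : ∀ x y, g (A.act x y) = B.act (g x) (g y)

instance : Category.{v} (PHData.{u, v} k) where
  Hom := Hom
  id A := ⟨CoalgHom.id k A.H, fun _ _ => rfl, rfl, fun _ _ => rfl⟩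
  comp f g := ⟨g.g.comp f.g, by simp [f.map_mul, g.map_mul], by simp [f.map_one, g.map_one],
    by simp [f.map_act, g.map_act]⟩

end PHData

/-- What Yetter-Drinfeld post-Hopf algebras and post-Hopf algebras have in common. -/
structure IsPrePostHopf {k : Type u} [Field k] (A : PHData.{u, v} k) : Prop extends
    IsAlg A.mul A.one, IsAntipode A.mul A.one A.S where
  /-- `⇀ : H ⊗ H → H` is a morphism of coalgebras -/
  comul_act : ∀ x y, Coalgebra.comul (R := k) (A.act x y) =
    sw₂ k x fun x₁ x₂ => sw₂ k y fun y₁ y₂ => A.act x₁ y₁ ⊗ₜ[k] A.act x₂ y₂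
  counit_act : ∀ x y, Coalgebra.counit (R := k) (A.act x y) =
    Coalgebra.counit (R := k) x * Coalgebra.counit (R := k) y
  act_mul : ∀ x y z, A.act x (A.mul y z) =
    sw₂ k x fun x₁ x₂ => A.mul (A.act x₁ y) (A.act x₂ z)
  act_act : ∀ x y z, A.act x (A.act y z) =
    A.act (sw₂ k x fun x₁ x₂ => A.mul x₁ (A.act x₂ y)) z
  /-- `α` is convolution invertible -/
  isUnit_α : IsUnit A.α

/-- Yetter-Drinfeld post-Hopf algebras. -/
structure IsYDPostHopf {k : Type u} [Field k] (A : PHData.{u, v} k) : Prop extends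
    IsPrePostHopf A where
  counit_mul : ∀ x y, Coalgebra.counit (R := k) (A.mul x y) =
    Coalgebra.counit (R := k) x * Coalgebra.counit (R := k) y
  counit_one : Coalgebra.counit (R := k) A.one = 1
  comul_one : Coalgebra.comul (R := k) A.one = A.one ⊗ₜ[k] A.one
  /-- `Δ(x · y) = x₁ · α x₂ (β x₄ y₁) ⊗ x₃ · y₂` -/
  comul_mul : ∀ x y, Coalgebra.comul (R := k) (A.mul x y) =
    sw₄ k x fun x₁ x₂ x₃ x₄ => sw₂ k y fun y₁ y₂ =>
      A.mul x₁ (A.act x₂ (A.β x₄ y₁)) ⊗ₜ[k] A.mul x₃ y₂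
  /-- `Δ S_⇀(x) = S_⇀(x₂) ⊗ S_⇀(x₁)` -/
  comul_subS : ∀ x, Coalgebra.comul (R := k) (A.subS x) =
    sw₂ k x fun x₁ x₂ => A.subS x₂ ⊗ₜ[k] A.subS x₁
  /-- `(x₁ ⇀ y₁) ⊗ (x₂ ↼ y₂) = (x₂ ⇀ y₂) ⊗ (x₁ ↼ y₁)` -/
  act_ract : ∀ x y,
    (sw₂ k x fun x₁ x₂ => sw₂ k y fun y₁ y₂ => A.act x₁ y₁ ⊗ₜ[k] A.ract x₂ y₂) =
      sw₂ k x fun x₁ x₂ => sw₂ k y fun y₁ y₂ => A.act x₂ y₂ ⊗ₜ[k] A.ract x₁ y₁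

/-- Cocommutative post-Hopf algebras: `(H, ·, 1, Δ, ε, S)` is an ordinary cocommutative Hopf
algebra. -/
structure IsCocommPostHopf {k : Type u} [Field k] (A : PHData.{u, v} k) : Prop extends
    IsPrePostHopf A, IsHopf A.mul A.one A.S where
  cocomm : Coalgebra.IsCocomm k A.H

variable (k : Type u) [Field k]

/-- The category of Yetter-Drinfeld post-Hopf algebras. -/
abbrev isYDPostHopf : ObjectProperty (PHData.{u, v} k) := fun A => IsYDPostHopf A
abbrev YDPostHopf := (isYDPostHopf.{u, v} k).FullSubcategory

/-- The category of cocommutative post-Hopf algebras. -/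
abbrev isCocommPostHopf : ObjectProperty (PHData.{u, v} k) := fun A => IsCocommPostHopf A
abbrev CocommPostHopf := (isCocommPostHopf.{u, v} k).FullSubcategory

/-! ### Relative Rota-Baxter operators -/

/-- Raw data for a coalgebra map `R : K → H`, where `H` carries a product, a unit and an antipode,
`K` carries a product and a unit, and `H` acts on `K`. Only the coalgebra axioms and the fact that
`R` is a coalgebra map are imposed here. -/
structure RelData where
  H : Type v
  K : Type v
  [addCommGroupH : AddCommGroup H]
  [moduleH : Module k H]
  [coalgebraH : Coalgebra k H]
  [addCommGroupK : AddCommGroup K]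
  [moduleK : Module k K]
  [coalgebraK : Coalgebra k K]
  mulH : H →ₗ[k] H →ₗ[k] H
  oneH : H
  SH : H →ₗ[k] H
  mulK : K →ₗ[k] K →ₗ[k] K
  oneK : K
  act : H →ₗ[k] K →ₗ[k] K
  R : K →ₗc[k] H

attribute [instance] RelData.addCommGroupH RelData.moduleH RelData.coalgebraH
  RelData.addCommGroupK RelData.moduleK RelData.coalgebraK

/-- The raw data together with a map `K → H ⊗ K` (the coaction). -/
structure RBData extends RelData.{u, v} k where
  coact : K →ₗ[k] H ⊗[k] K

variable {k}

namespace RelData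

/-- The inverse of a bijective `R`. -/
noncomputable def Rinv (X : RelData.{u, v} k) (h : Function.Bijective X.R) : X.H →ₗ[k] X.K :=
  (LinearEquiv.ofBijective (X.R : X.K →ₗ[k] X.H) h).symm

/-- Morphisms: pairs `(f : H → H', g : K → K')` of algebra and coalgebra maps with
`f R = R' g` and `g(a ⇀ x) = f(a) ⇀ g(x)`. -/
@[ext]
structure Hom (X Y : RelData.{u, v} k) where
  f : X.H →ₗc[k] Y.H
  g : X.K →ₗc[k] Y.K
  map_mulH : ∀ x y, f (X.mulH x y) = Y.mulH (f x) (f y)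
  map_oneH : f X.oneH = Y.oneH
  map_mulK : ∀ x y, g (X.mulK x y) = Y.mulK (g x) (g y)
  map_oneK : g X.oneK = Y.oneK
  map_R : ∀ x, f (X.R x) = Y.R (g x)
  map_act : ∀ a x, g (X.act a x) = Y.act (f a) (g x)

instance : Category.{v} (RelData.{u, v} k) where
  Hom := Hom
  id X := ⟨CoalgHom.id k X.H, CoalgHom.id k X.K, fun _ _ => rfl, rfl, fun _ _ => rfl, rfl,
    fun _ => rfl, fun _ _ => rfl⟩
  comp p q := ⟨q.f.comp p.f, q.g.comp p.g, by simp [p.map_mulH, q.map_mulH],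
    by simp [p.map_oneH, q.map_oneH], by simp [p.map_mulK, q.map_mulK],
    by simp [p.map_oneK, q.map_oneK], by simp [p.map_R, q.map_R], by simp [p.map_act, q.map_act]⟩

end RelData

instance : Category.{v} (RBData.{u, v} k) where
  Hom X Y := RelData.Hom X.toRelData Y.toRelData
  id X := 𝟙 X.toRelData
  comp p q := CategoryStruct.comp (obj := RelData.{u, v} k) p q
  id_comp := Category.id_comp (obj := RelData.{u, v} k)
  comp_id := Category.comp_id (obj := RelData.{u, v} k)
  assoc := Category.assoc (obj := RelData.{u, v} k)

/-- `R(a) R(b) = R(a₁ (R(a₂) ⇀ b))`. -/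
def RelData.RotaBaxter (X : RelData.{u, v} k) : Prop :=
  ∀ a b, X.mulH (X.R a) (X.R b) = X.R (sw₂ k a fun a₁ a₂ => X.mulK a₁ (X.act (X.R a₂) b))

/-- Yetter-Drinfeld relative pre-Rota-Baxter operators. -/
structure IsYDRelPreRB (X : RBData.{u, v} k) : Prop where
  hopf : IsHopf X.mulH X.oneH X.SH
  bimonoid : IsYDBimonoid X.mulH X.oneH X.SH X.mulK X.oneK X.act X.coact
  rotaBaxter : X.RotaBaxter
  /-- `S R(R(a₁) ⇀ b₁) R(a₂) R(b₂) ⊗ R(R(a₃) ⇀ b₃) =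
  S R(R(a₂) ⇀ b₂) R(a₃) R(b₃) ⊗ R(R(a₁) ⇀ b₁)` -/
  symmetric : ∀ a b,
    (sw₃ k a fun a₁ a₂ a₃ => sw₃ k b fun b₁ b₂ b₃ =>
      X.mulH (X.mulH (X.SH (X.R (X.act (X.R a₁) b₁))) (X.R a₂)) (X.R b₂) ⊗ₜ[k]
        X.R (X.act (X.R a₃) b₃)) =
    sw₃ k a fun a₁ a₂ a₃ => sw₃ k b fun b₁ b₂ b₃ =>
      X.mulH (X.mulH (X.SH (X.R (X.act (X.R a₂) b₂))) (X.R a₃)) (X.R b₃) ⊗ₜ[k]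
        X.R (X.act (X.R a₁) b₁)

/-- Yetter-Drinfeld relative Rota-Baxter operators. -/
structure IsYDRelRB (X : RBData.{u, v} k) : Prop extends IsYDRelPreRB X where
  bijective : Function.Bijective X.R
  /-- `(a₁ ⇀ R⁻¹ S(a₂)) R⁻¹(a₃) = ε(a) 1` -/
  inverse : ∀ a : X.H, (sw₃ k a fun a₁ a₂ a₃ =>
      X.mulK (X.act a₁ (X.Rinv bijective (X.SH a₂))) (X.Rinv bijective a₃)) =
    Coalgebra.counit (R := k) a • X.oneK

/-- Bijective relative Rota-Baxter operators on cocommutative Hopf algebras: `H` and `K` are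
ordinary cocommutative Hopf algebras, and `K` is an `H`-module bialgebra. -/
structure IsCocommBijRB (X : RelData.{u, v} k) : Prop where
  hopfH : IsHopf X.mulH X.oneH X.SH
  cocommH : Coalgebra.IsCocomm k X.H
  hopfK : ∃ SK : X.K →ₗ[k] X.K, IsHopf X.mulK X.oneK SK
  cocommK : Coalgebra.IsCocomm k X.K
  moduleBialgebra : IsModuleAlgCoalg X.mulH X.oneH X.mulK X.oneK X.act
  rotaBaxter : X.RotaBaxter
  bijective : Function.Bijective X.R

variable (k)

/-- The category of Yetter-Drinfeld relative Rota-Baxter operators. -/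
abbrev isYDRelRB : ObjectProperty (RBData.{u, v} k) := fun X => IsYDRelRB X
abbrev YDRelRB := (isYDRelRB.{u, v} k).FullSubcategory

/-- The full subcategory `D`: the coaction of `K` is `(Id ⊗ R⁻¹) Ad_L R`. -/
def isD : ObjectProperty (YDRelRB.{u, v} k) := fun X =>
  X.obj.coact = (X.obj.Rinv X.property.bijective).lTensor X.obj.H ∘ₗ
    adL X.obj.mulH X.obj.SH ∘ₗ (X.obj.R : X.obj.K →ₗ[k] X.obj.H)
abbrev CatD := (isD.{u, v} k).FullSubcategory

/-- The category of bijective relative Rota-Baxter operators on cocommutative Hopf algebras. -/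
abbrev isCocommBijRB : ObjectProperty (RelData.{u, v} k) := fun X => IsCocommBijRB X
abbrev CocommBijRB := (isCocommBijRB.{u, v} k).FullSubcategory

variable {k}

/-! ### The functors on raw data -/

theorem PHData.Hom.map_bullet {A B : PHData.{u, v} k} (p : PHData.Hom A B) (x y : A.H) :
    p.g (A.bullet x y) = B.bullet (p.g x) (p.g y) := by
  have key : ∀ t : A.H ⊗[k] A.H,
      p.g (TensorProduct.lift
        ((LinearMap.mul k (Module.End k A.H)).compl₁₂ A.mul A.act) t y) =
      TensorProduct.lift ((LinearMap.mul k (Module.End k B.H)).compl₁₂ B.mul B.act)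
        (TensorProduct.map (p.g : A.H →ₗ[k] B.H) (p.g : A.H →ₗ[k] B.H) t) (p.g y) := by
    intro t
    induction t with
    | zero => simp
    | tmul a b => simp [p.map_mul, p.map_act]
    | add a b ha hb => simp only [map_add, LinearMap.add_apply, ha, hb]
  simp only [PHData.bullet, LinearMap.comp_apply, key]
  rw [← CoalgHomClass.map_comp_comul_apply]

/-- The object part of `L`: the identity map `H → H_⇀`, where `H_⇀ = (H, •, 1, Δ, ε, S_⇀)` acts on
`(H, ·, 1, Δ, ε)` by `⇀` and coacts by its left adjoint coaction. -/
noncomputable def idObj (A : PHData.{u, v} k) : RBData.{u, v} k where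
  H := A.H
  K := A.H
  mulH := A.bullet
  oneH := A.one
  SH := A.subS
  mulK := A.mul
  oneK := A.one
  act := A.act
  R := CoalgHom.id k A.H
  coact := adL A.bullet A.subS

variable (k) in
/-- The functor `L` on raw data: `g ↦ (g, g)` on morphisms. -/
noncomputable def idFunctor : PHData.{u, v} k ⥤ RBData.{u, v} k where
  obj A := idObj A
  map {A B} p := (⟨p.g, p.g, p.map_bullet, p.map_one, p.map_mul, p.map_one, fun _ => rfl,
    p.map_act⟩ : RelData.Hom (idObj A).toRelData (idObj B).toRelData)

/-- The object part of `M`: the structure transported from `K` to `H` along a bijective `R`,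
`a ·_R b = R(R⁻¹(a) R⁻¹(b))`, `S_R(a) = R(a₁ ⇀ R⁻¹ S(a₂))`, `a ⇀_R b = R(a ⇀ R⁻¹(b))`; the unit,
`Δ` and `ε` are those of `H`. -/
noncomputable def transportObj (X : RelData.{u, v} k) (h : Function.Bijective X.R) :
    PHData.{u, v} k where
  H := X.H
  mul := (X.mulK.compl₁₂ (X.Rinv h) (X.Rinv h)).compr₂ (X.R : X.K →ₗ[k] X.H)
  one := X.oneH
  S := (X.R : X.K →ₗ[k] X.H) ∘ₗ TensorProduct.lift (X.act.compl₂ (X.Rinv h ∘ₗ X.SH)) ∘ₗ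
    Coalgebra.comul
  act := (X.act.compl₂ (X.Rinv h)).compr₂ (X.R : X.K →ₗ[k] X.H)

theorem RelData.R_Rinv (X : RelData.{u, v} k) (h : Function.Bijective X.R) (a : X.H) :
    X.R (X.Rinv h a) = a :=
  (LinearEquiv.ofBijective (X.R : X.K →ₗ[k] X.H) h).apply_symm_apply a

theorem RelData.Hom.map_Rinv {X Y : RelData.{u, v} k} (p : RelData.Hom X Y)
    (hX : Function.Bijective X.R) (hY : Function.Bijective Y.R) (a : X.H) :
    p.g (X.Rinv hX a) = Y.Rinv hY (p.f a) :=
  hY.1 (by rw [← p.map_R, X.R_Rinv, Y.R_Rinv])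

variable (k) in
/-- The functor `M` with values in raw data: `(f, g) ↦ f` on morphisms. -/
noncomputable def transportFunctor : YDRelRB.{u, v} k ⥤ PHData.{u, v} k where
  obj X := transportObj X.obj.toRelData X.property.bijective
  map {X Y} p :=
    let q : RelData.Hom X.obj.toRelData Y.obj.toRelData := p.hom
    have hq := q.map_Rinv X.property.bijective Y.property.bijective
    (⟨q.f,
      fun x y => (q.map_R _).trans (congrArg Y.obj.R ((q.map_mulK _ _).trans
        (congrArg₂ (fun u w => Y.obj.mulK u w) (hq x) (hq y)))),
      q.map_oneH,
      fun x y => (q.map_R _).trans (congrArg Y.obj.R ((q.map_act _ _).trans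
        (congrArg (fun w => Y.obj.act (q.f x) w) (hq y))))⟩ :
      PHData.Hom (transportObj X.obj.toRelData X.property.bijective)
        (transportObj Y.obj.toRelData Y.property.bijective))

/-- Raw data completed by the trivial coaction `x ↦ 1 ⊗ x`. -/
noncomputable def trivObj (X : RelData.{u, v} k) : RBData.{u, v} k where
  toRelData := X
  coact := TensorProduct.mk k X.H X.K X.oneH

variable (k) in
/-- Completing raw data by the trivial coaction, as a functor. -/
noncomputable def trivFunctor : RelData.{u, v} k ⥤ RBData.{u, v} k where
  obj X := trivObj X
  map p := p

/-! ### The functors between the categories -/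

/-- The functor `L`, given that its values are Yetter-Drinfeld relative Rota-Baxter operators that
lie in `D`. -/
noncomputable def functorL
    (h : ∀ A : YDPostHopf.{u, v} k, IsYDRelRB (idObj A.obj))
    (hD : ∀ A : YDPostHopf.{u, v} k, isD k ⟨idObj A.obj, h A⟩) :
    YDPostHopf.{u, v} k ⥤ CatD.{u, v} k :=
  (isD k).lift ((isYDRelRB k).lift ((isYDPostHopf k).ι ⋙ idFunctor k) h) hD

/-- The functor `M`, given that its values are Yetter-Drinfeld post-Hopf algebras. -/
noncomputable def functorM
    (h : ∀ X : CatD.{u, v} k,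
      IsYDPostHopf (transportObj X.obj.obj.toRelData X.obj.property.bijective)) :
    CatD.{u, v} k ⥤ YDPostHopf.{u, v} k :=
  (isYDPostHopf k).lift ((isD k).ι ⋙ transportFunctor k) h

/-- The inclusion of cocommutative post-Hopf algebras, given that they are Yetter-Drinfeld
post-Hopf algebras. -/
def inclPH (h : ∀ A : PHData.{u, v} k, IsCocommPostHopf A → IsYDPostHopf A) :
    CocommPostHopf.{u, v} k ⥤ YDPostHopf.{u, v} k :=
  ObjectProperty.ιOfLE h

/-- The inclusion of bijective relative Rota-Baxter operators on cocommutative Hopf algebras, given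
that with the trivial coaction they are objects of `D`. -/
noncomputable def inclRB
    (h : ∀ X : CocommBijRB.{u, v} k, IsYDRelRB (trivObj X.obj))
    (hD : ∀ X : CocommBijRB.{u, v} k, isD k ⟨trivObj X.obj, h X⟩) :
    CocommBijRB.{u, v} k ⥤ CatD.{u, v} k :=
  (isD k).lift ((isYDRelRB k).lift ((isCocommBijRB k).ι ⋙ trivFunctor k) h) hD

end YDPH

/-!
Sweedler calculations are carried out in convolution algebras of operators. For a coalgebra `C` and
a vector space `V`, the ring `ConvEnd k C V` consists of the linear maps `C → End V` with
`(P * Q)(c) = P(c₁) Q(c₂)`. A Sweedler expression in `c` whose components act one after the other on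
a vector is a word in this ring, antipodes are inverses, and a formula such as
`Δ(x • y) = x₁ • y₁ ⊗ x₂ • y₂` says that `Δ` intertwines (`Intertwines`) left multiplication `L` with
the word `L₁ L₂`, where the subscripts refer to the factors of `H ⊗ H` (`slot₁`, `slot₂`).
Intertwining is compatible with products and, by `Intertwines.inv`, with convolution inverses, so
most of the arguments become computations in groups of units.

For a Yetter-Drinfeld post-Hopf algebra let `ℓ` be left multiplication for `·` and `L` the one for
`•`. By definition `L = ℓ α`. The twisted formula for `Δ(x · y)` says that `Δ` intertwines `ℓ` with
`ℓ₁ α₁ ℓ₂ β₁`, and `⇀` being a coalgebra map says that it intertwines `α` with `α₁ α₂`; the product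
of the two is `L₁ L₂`, so `(H, •, Δ)` is a bialgebra. Since `ℓ` and `α` are invertible, so is `L`, and
the right inverse given by `S_⇀` is an antipode (`IsYDPrePostHopf.isHopf_bullet`).

The adjoint coaction `Ad` of a Hopf algebra is the conjugate `L₁ L₂ L₁⁻¹` evaluated at `1 ⊗ 1`, and
its comodule axioms are identities between such conjugates. The symmetry condition on `⇀` and `↼`
says that, over the coalgebra `H ⊗ H` and with `T = ⇀` and `m = •`, the elements `T₂` and `T₁⁻¹ m₁`
commute. Hence `T₁ T₂ T₁⁻¹ = m₁ T₂ m₁⁻¹`, which is the compatibility of `⇀` and `Ad`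
(`IsYDPostHopf.intertwines_adL_act`); the colinearity of `·` follows from `ℓ = L β`
(`IsYDPostHopf.intertwines_adL_mul`). So the
identity map of `H` is an object of `D`.

Conversely, let `R : K → H` be bijective. Transporting the product and the action of `K` to `H`, the
Rota-Baxter identity says that the product `•` of the transported structure is the given product of
`H` (`IsBijRelRB.transport_bullet`). Then `β(x)` is the action of `S(x)`, `S_⇀` is the antipode of `H`
(`IsBijRelRB.transport_subS`), and the axioms of a Yetter-Drinfeld post-Hopf algebra are those of `R`
read on `H`. Both composites of the two functors are the identity up to the isomorphisms `id` and
`(id, R⁻¹)`.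

Over a cocommutative coalgebra, words on different factors commute (`slot_comm`). Thus `α` and `β`
cancel in the formula for `Δ(x · y)`, `Ad` is trivial and the symmetry conditions hold. The remaining
axiom, that `a ↦ a₁ ⇀ R⁻¹ S(a₂)` is a left convolution inverse of `R⁻¹`, follows from the existence
of an antipode on `K`, because it is always a right inverse.
-/

namespace YDPH

/-! ### Sweedler sums as finite sums -/

section SweedlerSums

variable {k : Type*} [Field k]
variable {V W U U' V' W' : Type*} [AddCommGroup V] [Module k V] [AddCommGroup W] [Module k W]
  [AddCommGroup U] [Module k U] [AddCommGroup U'] [Module k U'] [AddCommGroup V'] [Module k V']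
  [AddCommGroup W'] [Module k W']

theorem sw_eq (T : V ⊗[k] W →ₗ[k] U) (t : V ⊗[k] W) {f : V → W → U}
    (h : ∀ x y, f x y = T (x ⊗ₜ[k] y)) : sw t f = T t := by
  conv_rhs => rw [(TensorProduct.exists_finset t).choose_spec]
  simp [sw, h]

theorem sw_tmul_of_linear (a : V) (b : W) (T : V ⊗[k] W →ₗ[k] U) {f : V → W → U}
    (h : ∀ x y, f x y = T (x ⊗ₜ[k] y)) : sw (a ⊗ₜ[k] b) f = f a b :=
  (sw_eq T _ h).trans (h a b).symm

theorem map_sw (g : U →ₗ[k] U') (t : V ⊗[k] W) (f : V → W → U) :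
    g (sw t f) = sw t fun x y => g (f x y) := by
  simp [sw]

theorem sw_apply (t : V ⊗[k] W) (f : V → W → U →ₗ[k] U') (u : U) :
    (sw t f) u = sw t fun x y => f x y u := by
  simp [sw]

theorem sw_tmul_left (t : V ⊗[k] W) (f : V → W → U) (u : U') :
    sw t f ⊗ₜ[k] u = sw t fun x y => f x y ⊗ₜ[k] u := by
  simp [sw, TensorProduct.sum_tmul]

theorem tmul_sw (t : V ⊗[k] W) (f : V → W → U) (u : U') :
    u ⊗ₜ[k] sw t f = sw t fun x y => u ⊗ₜ[k] f x y := by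
  simp [sw, TensorProduct.tmul_sum]

theorem smul_sw (t : V ⊗[k] W) (f : V → W → U) (c : k) :
    c • sw t f = sw t fun x y => c • f x y := by
  simp [sw, Finset.smul_sum]

theorem sw_comm {M : Type*} [AddCommGroup M] (s : V ⊗[k] W) (t : V' ⊗[k] W')
    (f : V → W → V' → W' → M) :
    (sw s fun x y => sw t fun z w => f x y z w) = sw t fun z w => sw s fun x y => f x y z w :=
  Finset.sum_comm

theorem apply_eq_sw (T : V ⊗[k] W →ₗ[k] U) (t : V ⊗[k] W) :
    T t = sw t fun x y => T (x ⊗ₜ[k] y) :=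
  (sw_eq T t fun _ _ => rfl).symm

theorem sw_tmul (a : V) (b : W) (F : V →ₗ[k] W →ₗ[k] U) :
    (sw (a ⊗ₜ[k] b) fun x y => F x y) = F a b := by
  simp [sw_eq_lift]

theorem sw_map (f : V →ₗ[k] V') (g : W →ₗ[k] W') (t : V ⊗[k] W) (F : V' →ₗ[k] W' →ₗ[k] U) :
    (sw (TensorProduct.map f g t) fun x y => F x y) = sw t fun x y => F (f x) (g y) := by
  rw [sw_eq_lift, ← LinearMap.comp_apply, apply_eq_sw]
  simp

theorem sw_sw₃_comm {M : Type*} [AddCommGroup M] [Coalgebra k U] (s : V ⊗[k] W) (c : U)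
    (f : V → W → U → U → U → M) :
    (sw s fun x y => sw₃ k c fun c₁ c₂ c₃ => f x y c₁ c₂ c₃) =
      sw₃ k c fun c₁ c₂ c₃ => sw s fun x y => f x y c₁ c₂ c₃ := by
  simp only [sw₃, sw₂]
  rw [sw_comm]
  congr 1
  funext c₁ c'
  rw [sw_comm]

/-- Coassociativity for Sweedler sums. -/
theorem sw₂_sw₂_left [Coalgebra k V] (a : V) (F : V →ₗ[k] V →ₗ[k] V →ₗ[k] U) :
    (sw₂ k a fun a' a₃ => sw₂ k a' fun a₁ a₂ => F a₁ a₂ a₃) =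
      sw₃ k a fun a₁ a₂ a₃ => F a₁ a₂ a₃ := by
  let Φ : (V ⊗[k] V) ⊗[k] V →ₗ[k] U := TensorProduct.lift (TensorProduct.lift F)
  have h₁ : (sw₂ k a fun a' a₃ => sw₂ k a' fun a₁ a₂ => F a₁ a₂ a₃) =
      Φ ((Coalgebra.comul (R := k)).rTensor V (Coalgebra.comul (R := k) a)) := by
    refine sw_eq (Φ ∘ₗ (Coalgebra.comul (R := k)).rTensor V) _ fun b c => ?_
    simp only [Φ, LinearMap.comp_apply, LinearMap.rTensor_tmul, TensorProduct.lift.tmul,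
      ← sw_eq_lift, sw_apply, sw₂]
  have h₂ : (sw₃ k a fun a₁ a₂ a₃ => F a₁ a₂ a₃) =
      Φ ((TensorProduct.assoc k V V V).symm
        ((Coalgebra.comul (R := k)).lTensor V (Coalgebra.comul (R := k) a))) := by
    refine sw_eq (Φ ∘ₗ (TensorProduct.assoc k V V V).symm.toLinearMap ∘ₗ
      (Coalgebra.comul (R := k)).lTensor V) (Coalgebra.comul (R := k) a)
      (f := fun b c => sw₂ k c fun d e => F b d e) fun b c => ?_
    refine sw_eq (Φ ∘ₗ (TensorProduct.assoc k V V V).symm.toLinearMap ∘ₗ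
      TensorProduct.mk k V (V ⊗[k] V) b) _ (f := fun d e => F b d e) fun d e => ?_
    simp [Φ]
  rw [h₁, h₂, Coalgebra.coassoc_symm_apply]

end SweedlerSums

/-! ### Convolution of operator-valued maps -/

section Convolution

variable {k : Type*} [Field k]
variable {C D V W : Type*} [AddCommGroup C] [Module k C] [Coalgebra k C]
  [AddCommGroup D] [Module k D] [Coalgebra k D]
  [AddCommGroup V] [Module k V] [AddCommGroup W] [Module k W]

variable (k C V) in
/-- The convolution algebra of linear maps from a coalgebra `C` to the operators on `V`. A Sweedler
expression in which the components `c₁, c₂, …` act one after the other is a word in this ring. -/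
abbrev ConvEnd := WithConv (C →ₗ[k] Module.End k V)

omit [Coalgebra k C] in
theorem ConvEnd.ext {P Q : ConvEnd k C V} (h : ∀ c v, P.ofConv c v = Q.ofConv c v) : P = Q :=
  WithConv.ext (LinearMap.ext fun c => LinearMap.ext fun v => h c v)

theorem conv_apply (P Q : ConvEnd k C V) (c : C) (v : V) :
    (P * Q).ofConv c v = sw₂ k c fun c₁ c₂ => P.ofConv c₁ (Q.ofConv c₂ v) := by
  rw [LinearMap.convMul_apply, sw₂]
  conv_lhs => rw [(TensorProduct.exists_finset (Coalgebra.comul (R := k) c)).choose_spec]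
  simp [sw]

omit [Coalgebra k C] in
theorem apply_tensor_eq_sw (P : ConvEnd k C (V ⊗[k] W)) (c : C) (t : V ⊗[k] W) :
    P.ofConv c t = sw t fun v w => P.ofConv c (v ⊗ₜ[k] w) :=
  apply_eq_sw _ _

theorem conv_one_apply (c : C) (v : V) :
    (1 : ConvEnd k C V).ofConv c v = Coalgebra.counit (R := k) c • v := by
  simp [Algebra.algebraMap_eq_smul_one]

theorem conv_tmul (P Q : ConvEnd k (C ⊗[k] D) V) (a : C) (b : D) (v : V) :
    (P * Q).ofConv (a ⊗ₜ[k] b) v = sw₂ k a fun a₁ a₂ => sw₂ k b fun b₁ b₂ =>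
      P.ofConv (a₁ ⊗ₜ[k] b₁) (Q.ofConv (a₂ ⊗ₜ[k] b₂) v) := by
  rw [LinearMap.convMul_apply, sw₂, TensorProduct.comul_tmul]
  conv_lhs => rw [(TensorProduct.exists_finset (Coalgebra.comul (R := k) a)).choose_spec,
    (TensorProduct.exists_finset (Coalgebra.comul (R := k) b)).choose_spec]
  simp [sw, sw₂, TensorProduct.sum_tmul, TensorProduct.tmul_sum, LinearMap.sum_apply]
  exact Finset.sum_comm

theorem conv₃_apply (P Q R : ConvEnd k C V) (c : C) (v : V) :
    (P * Q * R).ofConv c v = sw₃ k c fun c₁ c₂ c₃ =>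
      P.ofConv c₁ (Q.ofConv c₂ (R.ofConv c₃ v)) := by
  simp only [mul_assoc, conv_apply, sw₃, sw₂, map_sw]

theorem conv₃_tmul (P Q R : ConvEnd k (C ⊗[k] D) V) (a : C) (b : D) (v : V) :
    (P * Q * R).ofConv (a ⊗ₜ[k] b) v = sw₃ k a fun a₁ a₂ a₃ => sw₃ k b fun b₁ b₂ b₃ =>
      P.ofConv (a₁ ⊗ₜ[k] b₁) (Q.ofConv (a₂ ⊗ₜ[k] b₂) (R.ofConv (a₃ ⊗ₜ[k] b₃) v)) := by
  simp only [mul_assoc, conv_tmul, sw₃, sw₂, map_sw]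
  congr 1
  funext a₁ a'
  rw [sw_comm]

/-- At a group-like element the convolution product is the product of operators. -/
theorem conv_apply_of_comul {c : C} (h : Coalgebra.comul (R := k) c = c ⊗ₜ[k] c)
    (P Q : ConvEnd k C V) (v : V) : (P * Q).ofConv c v = P.ofConv c (Q.ofConv c v) := by
  rw [LinearMap.convMul_apply, h]
  simp

/-- The convolution of an operator-valued map with a vector-valued one, `c ↦ P(c₁)(X(c₂))`. -/
noncomputable def cact (P : ConvEnd k C V) (X : C →ₗ[k] V) : C →ₗ[k] V :=
  TensorProduct.lift (P.ofConv.compl₂ X) ∘ₗ Coalgebra.comul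

theorem cact_apply (P : ConvEnd k C V) (X : C →ₗ[k] V) (c : C) :
    cact P X c = sw₂ k c fun c₁ c₂ => P.ofConv c₁ (X c₂) :=
  (sw_eq_lift (Coalgebra.comul (R := k) c) (P.ofConv.compl₂ X)).symm

theorem one_cact (X : C →ₗ[k] V) : cact 1 X = X := by
  ext c
  have h : ∀ t : C ⊗[k] C, TensorProduct.lift ((1 : ConvEnd k C V).ofConv.compl₂ X) t =
      X (TensorProduct.lid k C ((Coalgebra.counit (R := k)).rTensor C t)) := by
    intro t
    induction t with
    | zero => simp
    | tmul a b => simp [Algebra.algebraMap_eq_smul_one]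
    | add a b ha hb => simp only [map_add, ha, hb]
  simp only [cact, LinearMap.comp_apply, h, Coalgebra.rTensor_counit_comul]
  simp

theorem mul_cact (P Q : ConvEnd k C V) (X : C →ₗ[k] V) :
    cact (P * Q) X = cact P (cact Q X) := by
  ext c
  let Φ : C ⊗[k] (C ⊗[k] C) →ₗ[k] V :=
    TensorProduct.lift (P.ofConv.compl₂ (TensorProduct.lift (Q.ofConv.compl₂ X)))
  have h₁ : ∀ t : C ⊗[k] C, TensorProduct.lift ((P * Q).ofConv.compl₂ X) t =
      Φ (TensorProduct.assoc k C C C ((Coalgebra.comul (R := k)).rTensor C t)) := by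
    intro t
    induction t with
    | zero => simp
    | tmul a b =>
      simp only [TensorProduct.lift.tmul, LinearMap.compl₂_apply, LinearMap.rTensor_tmul]
      rw [LinearMap.convMul_apply]
      generalize Coalgebra.comul (R := k) a = s
      induction s with
      | zero => simp
      | tmul a b => simp [Φ]
      | add a b ha hb => simp only [map_add, LinearMap.add_apply, TensorProduct.add_tmul, ha, hb]
    | add a b ha hb => simp only [map_add, ha, hb]
  have h₂ : ∀ t : C ⊗[k] C, TensorProduct.lift (P.ofConv.compl₂ (cact Q X)) t =
      Φ ((Coalgebra.comul (R := k)).lTensor C t) := by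
    intro t
    induction t with
    | zero => simp
    | tmul a b => simp [Φ, cact]
    | add a b ha hb => simp only [map_add, ha, hb]
  change TensorProduct.lift ((P * Q).ofConv.compl₂ X) (Coalgebra.comul (R := k) c) =
    TensorProduct.lift (P.ofConv.compl₂ (cact Q X)) (Coalgebra.comul (R := k) c)
  rw [h₁, h₂, Coalgebra.coassoc_apply]

/-- `P` acting on the first factor of `V ⊗ W`. -/
noncomputable def slot₁ (W : Type*) [AddCommGroup W] [Module k W] (P : ConvEnd k C V) :
    ConvEnd k C (V ⊗[k] W) :=
  WithConv.toConv ((Module.End.rTensorAlgHom k V W).toLinearMap ∘ₗ P.ofConv)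

/-- `P` acting on the second factor of `V ⊗ W`. -/
noncomputable def slot₂ (V : Type*) [AddCommGroup V] [Module k V] (P : ConvEnd k C W) :
    ConvEnd k C (V ⊗[k] W) :=
  WithConv.toConv ((Module.End.lTensorAlgHom k W V).toLinearMap ∘ₗ P.ofConv)

omit [Coalgebra k C] in
theorem slot₁_tmul (P : ConvEnd k C V) (c : C) (v : V) (w : W) :
    (slot₁ W P).ofConv c (v ⊗ₜ[k] w) = P.ofConv c v ⊗ₜ[k] w := rfl

omit [Coalgebra k C] in
theorem slot₂_tmul (P : ConvEnd k C W) (c : C) (v : V) (w : W) :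
    (slot₂ V P).ofConv c (v ⊗ₜ[k] w) = v ⊗ₜ[k] P.ofConv c w := rfl

theorem slot₁_mul (P Q : ConvEnd k C V) : slot₁ W (P * Q) = slot₁ W P * slot₁ W Q :=
  WithConv.ext (LinearMap.algHom_comp_convMul_distrib _ P Q)

theorem slot₂_mul (P Q : ConvEnd k C W) : slot₂ V (P * Q) = slot₂ V P * slot₂ V Q :=
  WithConv.ext (LinearMap.algHom_comp_convMul_distrib _ P Q)

theorem slot₁_one : slot₁ W (1 : ConvEnd k C V) = 1 := by
  ext c : 2
  exact AlgHom.commutes (Module.End.rTensorAlgHom k V W) (Coalgebra.counit (R := k) c)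

theorem slot₂_one : slot₂ V (1 : ConvEnd k C W) = 1 := by
  ext c : 2
  exact AlgHom.commutes (Module.End.lTensorAlgHom k W V) (Coalgebra.counit (R := k) c)

theorem slot₁_mul_eq_one {P Q : ConvEnd k C V} (h : P * Q = 1) :
    slot₁ W P * slot₁ W Q = 1 := by
  rw [← slot₁_mul, h, slot₁_one]

theorem slot₂_mul_eq_one {P Q : ConvEnd k C W} (h : P * Q = 1) :
    slot₂ V P * slot₂ V Q = 1 := by
  rw [← slot₂_mul, h, slot₂_one]

theorem mul_mul_eq_one {M : Type*} [Monoid M] {a a' b b' : M} (ha : a * a' = 1)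
    (hb : b * b' = 1) : a * b * (b' * a') = 1 := by
  rw [mul_assoc, ← mul_assoc b, hb, one_mul, ha]

/-- Left multiplication by `f(c)`. -/
def lm (mul : V →ₗ[k] V →ₗ[k] V) (f : C →ₗ[k] V) : ConvEnd k C V := WithConv.toConv (mul ∘ₗ f)

omit [Coalgebra k C] in
theorem lm_apply (mul : V →ₗ[k] V →ₗ[k] V) (f : C →ₗ[k] V) (c : C) (v : V) :
    (lm mul f).ofConv c v = mul (f c) v := rfl

/-- The composite of `P` with a coalgebra morphism. -/
def pull (φ : D →ₗc[k] C) (P : ConvEnd k C V) : ConvEnd k D V :=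
  WithConv.toConv (P.ofConv ∘ₗ (φ : D →ₗ[k] C))

theorem pull_apply (φ : D →ₗc[k] C) (P : ConvEnd k C V) (d : D) :
    (pull φ P).ofConv d = P.ofConv (φ d) := rfl

theorem pull_mul (φ : D →ₗc[k] C) (P Q : ConvEnd k C V) :
    pull φ (P * Q) = pull φ P * pull φ Q :=
  WithConv.ext (LinearMap.convMul_comp_coalgHom_distrib P Q φ)

theorem pull_one (φ : D →ₗc[k] C) : pull φ (1 : ConvEnd k C V) = 1 := by
  ext d : 2
  simp [pull_apply]

theorem conv_comm_of_isCocomm [Coalgebra.IsCocomm k C] (P Q : ConvEnd k C V)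
    (h : ∀ x y v, P.ofConv x (Q.ofConv y v) = Q.ofConv y (P.ofConv x v)) : P * Q = Q * P := by
  ext c : 2
  rw [LinearMap.convMul_apply, LinearMap.convMul_apply]
  conv_rhs => rw [← Coalgebra.comm_comul k c]
  generalize Coalgebra.comul (R := k) c = s
  induction s with
  | zero => simp
  | tmul a b => simpa using LinearMap.ext (h a b)
  | add a b ha hb => simp only [map_add, ha, hb]

/-- Operators on different factors commute, so over a cocommutative coalgebra the corresponding
words may be interchanged. -/
theorem slot_comm [Coalgebra.IsCocomm k C] (P : ConvEnd k C V) (Q : ConvEnd k C W) :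
    slot₁ W P * slot₂ V Q = slot₂ V Q * slot₁ W P := by
  refine conv_comm_of_isCocomm _ _ fun x y t => ?_
  induction t with
  | zero => simp
  | tmul a b => simp [slot₁_tmul, slot₂_tmul]
  | add a b ha hb => simp only [map_add, ha, hb]

/-- `T` intertwines the operators `P(c)` and `Q(c)`. -/
def Intertwines (T : V →ₗ[k] W) (P : ConvEnd k C V) (Q : ConvEnd k C W) : Prop :=
  ∀ c v, T (P.ofConv c v) = Q.ofConv c (T v)

theorem Intertwines.mul {T : V →ₗ[k] W} {P P' : ConvEnd k C V} {Q Q' : ConvEnd k C W}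
    (h : Intertwines T P Q) (h' : Intertwines T P' Q') : Intertwines T (P * P') (Q * Q') := by
  intro c v
  simp only [conv_apply, sw₂, map_sw, h _ _, h' _ _]

/-- Intertwining passes to convolution inverses. -/
theorem Intertwines.inv {T : V →ₗ[k] W} {P P' : ConvEnd k C V} {Q Q' : ConvEnd k C W}
    (h : Intertwines T P Q) (hP : P * P' = 1) (hQ : Q' * Q = 1) : Intertwines T P' Q' := by
  intro c v
  let X : C →ₗ[k] W := T ∘ₗ P'.ofConv.flip v
  have h₁ : cact Q X = (Coalgebra.counit (R := k) (A := C)).smulRight (T v) := by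
    ext c
    have : cact Q X c = T ((P * P').ofConv c v) := by
      simp only [cact_apply, conv_apply, sw₂, map_sw, h _ _]
      rfl
    rw [this, hP, conv_one_apply]
    simp
  have h₂ : cact Q' (cact Q X) = X := by rw [← mul_cact, hQ, one_cact]
  have h₃ : X c = cact Q' ((Coalgebra.counit (R := k) (A := C)).smulRight (T v)) c := by
    rw [← h₁, h₂]
  have h₄ : cact Q' ((Coalgebra.counit (R := k) (A := C)).smulRight (T v)) c =
      (Q' * 1).ofConv c (T v) := by
    simp only [cact_apply, conv_apply, conv_one_apply, LinearMap.smulRight_apply]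
  rw [h₄, mul_one] at h₃
  exact h₃

end Convolution

/-! ### Hopf algebras in terms of multiplication operators -/

section Hopf

variable {k : Type*} [Field k] {H : Type*} [AddCommGroup H] [Module k H] [Coalgebra k H]
  {mul : H →ₗ[k] H →ₗ[k] H} {one : H} {S : H →ₗ[k] H}

theorem adL_apply (mul : H →ₗ[k] H →ₗ[k] H) (S : H →ₗ[k] H) (x : H) :
    adL mul S x = sw₃ k x fun x₁ x₂ x₃ => mul x₁ (S x₃) ⊗ₜ[k] x₂ := by
  simp only [adL, LinearMap.comp_apply, sw₃, sw₂]
  rw [apply_eq_sw (LinearMap.lTensor H _) (Coalgebra.comul x)]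
  simp only [LinearMap.lTensor_tmul, LinearMap.comp_apply, map_sw]
  congr 1
  funext x₁ x'
  rw [apply_eq_sw (TensorProduct.comm k H H).toLinearMap (Coalgebra.comul x'), tmul_sw]
  simp [map_sw]

theorem sw_adL (mul : H →ₗ[k] H →ₗ[k] H) (S : H →ₗ[k] H) {U : Type*} [AddCommGroup U] [Module k U]
    (x : H) (F : H →ₗ[k] H →ₗ[k] U) :
    (sw (adL mul S x) fun y z => F y z) = sw₃ k x fun x₁ x₂ x₃ => F (mul x₁ (S x₃)) x₂ := by
  rw [sw_eq_lift, adL_apply]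
  simp only [sw₃, sw₂, map_sw, TensorProduct.lift.tmul]

theorem IsAlg.lm_mul_lm_antipode (h : IsAlg mul one) (hS : IsAntipode mul one S) :
    lm mul .id * lm mul S = 1 := by
  refine ConvEnd.ext fun x v => ?_
  have := congrArg (fun z => mul z v) (hS.mul_S x)
  simpa only [sw₂, map_sw, sw_apply, map_smul, LinearMap.smul_apply, h.one_mul, h.mul_assoc,
    conv_apply, conv_one_apply, lm_apply, LinearMap.id_apply] using this

theorem IsAlg.lm_antipode_mul_lm (h : IsAlg mul one) (hS : IsAntipode mul one S) :
    lm mul S * lm mul .id = 1 := by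
  refine ConvEnd.ext fun x v => ?_
  have := congrArg (fun z => mul z v) (hS.S_mul x)
  simpa only [sw₂, map_sw, sw_apply, map_smul, LinearMap.smul_apply, h.one_mul, h.mul_assoc,
    conv_apply, conv_one_apply, lm_apply, LinearMap.id_apply] using this

/-- The operators of left multiplication determine the antipode axioms. -/
theorem IsAlg.isAntipode_of_lm (h : IsAlg mul one) (h₁ : lm mul .id * lm mul S = 1)
    (h₂ : lm mul S * lm mul .id = 1) : IsAntipode mul one S where
  mul_S x := by
    have := congrArg (fun P : ConvEnd k H H => P.ofConv x one) h₁
    simpa only [conv_apply, conv_one_apply, lm_apply, LinearMap.id_apply, h.mul_one] using this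
  S_mul x := by
    have := congrArg (fun P : ConvEnd k H H => P.ofConv x one) h₂
    simpa only [conv_apply, conv_one_apply, lm_apply, LinearMap.id_apply, h.mul_one] using this

namespace IsHopf

section

variable (h : IsHopf mul one S)
include h

theorem mul_antipode : lm mul .id * lm mul S = 1 :=
  h.toIsAlg.lm_mul_lm_antipode h.toIsAntipode

theorem antipode_mul : lm mul S * lm mul .id = 1 :=
  h.toIsAlg.lm_antipode_mul_lm h.toIsAntipode

theorem intertwines_comul : Intertwines (Coalgebra.comul (R := k)) (lm mul .id)
    (slot₁ H (lm mul .id) * slot₂ H (lm mul .id)) := by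
  intro x y
  rw [apply_tensor_eq_sw]
  simp only [conv_apply, slot₁_tmul, slot₂_tmul, lm_apply, LinearMap.id_apply]
  exact (h.comul_mul x y).trans (sw_comm _ _ _)

/-- The antipode reverses the coproduct: left multiplications on the two factors of `H ⊗ H` are
invertible, and intertwining with `Δ` passes to the inverses. -/
theorem comul_S (x : H) : Coalgebra.comul (R := k) (S x) =
    sw₂ k x fun x₁ x₂ => S x₂ ⊗ₜ[k] S x₁ := by
  have := h.intertwines_comul.inv h.mul_antipode
    (mul_mul_eq_one (slot₂_mul_eq_one h.antipode_mul) (slot₁_mul_eq_one h.antipode_mul)) x one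
  simpa only [conv_apply, h.comul_one, slot₁_tmul, slot₂_tmul, lm_apply, h.mul_one] using this

theorem S_one : S one = one := by
  have := congrArg (fun P : ConvEnd k H H => P.ofConv one one) h.mul_antipode
  simpa only [conv_apply_of_comul h.comul_one, conv_one_apply, h.counit_one, h.one_mul, h.mul_one,
    lm_apply, LinearMap.id_apply, one_smul] using this

end

end IsHopf

/-- A bilinear map that is compatible with coproducts and counits, as a coalgebra morphism. -/
noncomputable def tensorHom {K L : Type*} [AddCommGroup K] [Module k K] [Coalgebra k K]
    [AddCommGroup L] [Module k L] [Coalgebra k L] (F : H →ₗ[k] K →ₗ[k] L)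
    (hΔ : ∀ x y, Coalgebra.comul (R := k) (F x y) =
      sw₂ k x fun x₁ x₂ => sw₂ k y fun y₁ y₂ => F x₁ y₁ ⊗ₜ[k] F x₂ y₂)
    (hε : ∀ x y, Coalgebra.counit (R := k) (F x y) =
      Coalgebra.counit (R := k) x * Coalgebra.counit (R := k) y) : H ⊗[k] K →ₗc[k] L where
  __ := TensorProduct.lift F
  counit_comp := by
    ext x y
    simp [hε, mul_comm]
  map_comp_comul := by
    ext x y
    simp only [TensorProduct.AlgebraTensorModule.curry_apply, LinearMap.restrictScalars_self,
      TensorProduct.curry_apply, LinearMap.comp_apply, TensorProduct.lift.tmul, hΔ, sw₂,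
      TensorProduct.comul_tmul]
    conv_lhs => rw [(TensorProduct.exists_finset (Coalgebra.comul (R := k) x)).choose_spec,
      (TensorProduct.exists_finset (Coalgebra.comul (R := k) y)).choose_spec]
    simp [sw, TensorProduct.sum_tmul, TensorProduct.tmul_sum]
    exact Finset.sum_comm

theorem tensorHom_tmul {K L : Type*} [AddCommGroup K] [Module k K] [Coalgebra k K]
    [AddCommGroup L] [Module k L] [Coalgebra k L] (F : H →ₗ[k] K →ₗ[k] L) (hΔ) (hε) (x : H) (y : K) :
    tensorHom F hΔ hε (x ⊗ₜ[k] y) = F x y := rfl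

namespace IsHopf

section

variable (h : IsHopf mul one S)
include h

/-- The antipode reverses products: both sides give a convolution inverse of the product, seen on
the coalgebra `H ⊗ H`. -/
theorem S_mul_rev (x y : H) : S (mul x y) = mul (S y) (S x) := by
  let m := tensorHom mul h.comul_mul h.counit_mul
  let N : ConvEnd k (H ⊗[k] H) H := lm mul (TensorProduct.lift (mul.compl₁₂ S S).flip)
  have h₁ : pull m (lm mul S) * pull m (lm mul .id) = 1 := by
    rw [← pull_mul, h.antipode_mul, pull_one]
  have h₂ : pull m (lm mul .id) * N = 1 := by
    refine ConvEnd.ext fun t v => ?_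
    induction t with
    | zero => simp
    | add a b ha hb => simp only [map_add, LinearMap.add_apply, ha, hb]
    | tmul x y =>
      have hx := congrArg (fun P : ConvEnd k H H => P.ofConv x v) h.mul_antipode
      have hy := fun v => congrArg (fun P : ConvEnd k H H => P.ofConv y v) h.mul_antipode
      simp only [conv_apply, conv_one_apply, lm_apply, LinearMap.id_apply] at hx hy
      simp only [conv_tmul, conv_one_apply, TensorProduct.counit_tmul, pull_apply, lm_apply, N]
      simp only [m, tensorHom_tmul, LinearMap.id_apply, TensorProduct.lift.tmul,
        LinearMap.flip_apply, LinearMap.compl₁₂_apply, h.mul_assoc]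
      simp only [sw₂] at hx hy ⊢
      simp only [← map_sw, hy, map_smul, ← smul_sw, hx]
      rw [smul_eq_mul, mul_smul]
  have h₃ := congrArg (fun P : ConvEnd k (H ⊗[k] H) H => P.ofConv (x ⊗ₜ[k] y) one)
    (left_inv_eq_right_inv h₁ h₂)
  simpa [pull_apply, lm_apply, h.mul_one, m, N, tensorHom_tmul] using h₃

/-- The adjoint coaction is the conjugation of one factor of `H ⊗ H` by the other. -/
theorem adL_eq (x : H) : adL mul S x = (slot₁ H (lm mul .id) * slot₂ H (lm mul .id) *
    slot₁ H (lm mul S)).ofConv x (one ⊗ₜ[k] one) := by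
  simp only [adL_apply, conv₃_apply, slot₁_tmul, slot₂_tmul, lm_apply, LinearMap.id_apply,
    h.mul_one]

theorem adL_one : adL mul S one = one ⊗ₜ[k] one := by
  simp only [h.adL_eq, conv_apply_of_comul h.comul_one, slot₁_tmul, slot₂_tmul, lm_apply,
    LinearMap.id_apply, h.mul_one, h.S_one]

theorem adL_counit (x : H) :
    (sw (adL mul S x) fun x' x₀ => Coalgebra.counit (R := k) x' • x₀) = x := by
  let E : H ⊗[k] H →ₗ[k] H := TensorProduct.lid k H ∘ₗ (Coalgebra.counit (R := k)).rTensor H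
  have hE : ∀ a b, E (a ⊗ₜ[k] b) = Coalgebra.counit (R := k) a • b := fun a b => by simp [E]
  have h₁ : Intertwines E (slot₁ H (lm mul .id)) 1 := by
    intro a t
    induction t with
    | zero => simp
    | tmul b c => simp only [slot₁_tmul, lm_apply, hE, h.counit_mul, conv_one_apply, mul_smul,
        LinearMap.id_apply]
    | add b c hb hc => simp only [map_add, hb, hc]
  have h₂ : Intertwines E (slot₂ H (lm mul .id)) (lm mul .id) := by
    intro a t
    induction t with
    | zero => simp
    | tmul b c => simp only [slot₂_tmul, lm_apply, hE, map_smul]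
    | add b c hb hc => simp only [map_add, hb, hc]
  have h₃ := h₁.inv (slot₁_mul_eq_one h.mul_antipode) (one_mul 1)
  rw [sw_eq E _ fun a b => (hE a b).symm, h.adL_eq, (h₁.mul h₂).mul h₃]
  simp only [one_mul, mul_one, hE, h.counit_one, lm_apply, one_smul, LinearMap.id_apply, h.mul_one]

theorem adL_counit_right (x : H) :
    (sw (adL mul S x) fun x' x₀ => Coalgebra.counit (R := k) x₀ • x') =
      Coalgebra.counit (R := k) x • one := by
  let E : H ⊗[k] H →ₗ[k] H := TensorProduct.rid k H ∘ₗ (Coalgebra.counit (R := k)).lTensor H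
  have hE : ∀ a b, E (a ⊗ₜ[k] b) = Coalgebra.counit (R := k) b • a := fun a b => by simp [E]
  have h₁ : ∀ f : H →ₗ[k] H, Intertwines E (slot₁ H (lm mul f)) (lm mul f) := by
    intro f a t
    induction t with
    | zero => simp
    | tmul b c => simp only [slot₁_tmul, lm_apply, hE, map_smul]
    | add b c hb hc => simp only [map_add, hb, hc]
  have h₂ : Intertwines E (slot₂ H (lm mul .id)) 1 := by
    intro a t
    induction t with
    | zero => simp
    | tmul b c => simp only [slot₂_tmul, lm_apply, hE, h.counit_mul, conv_one_apply, mul_smul,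
        LinearMap.id_apply]
    | add b c hb hc => simp only [map_add, hb, hc]
  rw [sw_eq E _ fun a b => (hE a b).symm, h.adL_eq, ((h₁ .id).mul h₂).mul (h₁ S)]
  simp only [mul_one, h.mul_antipode, hE, h.counit_one, conv_one_apply, one_smul]

/-- In the cocommutative case the adjoint coaction is trivial. -/
theorem adL_of_isCocomm [Coalgebra.IsCocomm k H] (x : H) : adL mul S x = one ⊗ₜ[k] x := by
  rw [h.adL_eq, slot_comm, mul_assoc, slot₁_mul_eq_one h.mul_antipode, mul_one, slot₂_tmul]
  exact congrArg _ (h.mul_one x)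

/-- Coassociativity of the adjoint coaction: with `iⱼ` the left multiplication on the `j`-th factor
of `H ⊗ H ⊗ H`, both sides are given by the word `i₁ i₂ i₃ i₂⁻¹ i₁⁻¹`. -/
theorem adL_coassoc (x : H) : TensorProduct.assoc k H H H
    ((Coalgebra.comul (R := k) (A := H)).rTensor H (adL mul S x)) =
      (adL mul S).lTensor H (adL mul S x) := by
  let P : ConvEnd k H H := lm mul .id
  let Q : ConvEnd k H H := lm mul S
  let i₁ : ConvEnd k H (H ⊗[k] (H ⊗[k] H)) := slot₁ (H ⊗[k] H) P
  let i₁' : ConvEnd k H (H ⊗[k] (H ⊗[k] H)) := slot₁ (H ⊗[k] H) Q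
  let i₂ : ConvEnd k H (H ⊗[k] (H ⊗[k] H)) := slot₂ H (slot₁ H P)
  let i₂' : ConvEnd k H (H ⊗[k] (H ⊗[k] H)) := slot₂ H (slot₁ H Q)
  let i₃ : ConvEnd k H (H ⊗[k] (H ⊗[k] H)) := slot₂ H (slot₂ H P)
  let T : H ⊗[k] H →ₗ[k] H ⊗[k] (H ⊗[k] H) :=
    (TensorProduct.assoc k H H H).toLinearMap ∘ₗ (Coalgebra.comul (R := k) (A := H)).rTensor H
  have h₁ : Intertwines T (slot₁ H P) (i₁ * i₂) := by
    intro a t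
    induction t with
    | zero => simp
    | tmul b c =>
      have := h.intertwines_comul a b
      simp only [T, LinearMap.comp_apply, slot₁_tmul, LinearMap.rTensor_tmul]
      rw [this]
      generalize Coalgebra.comul (R := k) b = s
      induction s with
      | zero => simp
      | tmul b d =>
        simp only [conv_apply, slot₁_tmul, slot₂_tmul, sw₂, sw_tmul_left, map_sw, i₁, i₂,
          LinearEquiv.coe_coe, TensorProduct.assoc_tmul, P]
      | add b d hb hd => simp only [map_add, TensorProduct.add_tmul, hb, hd]
    | add b c hb hc => simp only [map_add, hb, hc]
  have h₂ : Intertwines T (slot₂ H P) i₃ := by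
    intro a t
    induction t with
    | zero => simp
    | tmul b c =>
      simp only [T, LinearMap.comp_apply, slot₂_tmul, LinearMap.rTensor_tmul]
      generalize Coalgebra.comul (R := k) b = s
      induction s with
      | zero => simp
      | tmul b d => simp only [LinearEquiv.coe_coe, TensorProduct.assoc_tmul, i₃, slot₂_tmul]
      | add b d hb hd => simp only [map_add, TensorProduct.add_tmul, hb, hd]
    | add b c hb hc => simp only [map_add, hb, hc]
  have h₃ : Intertwines T (slot₁ H Q) (i₂' * i₁') :=
    h₁.inv (slot₁_mul_eq_one h.mul_antipode)
      (mul_mul_eq_one (slot₂_mul_eq_one (slot₁_mul_eq_one h.antipode_mul))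
        (slot₁_mul_eq_one h.antipode_mul))
  have hT : T (one ⊗ₜ[k] one) = one ⊗ₜ[k] (one ⊗ₜ[k] one) := by
    simp [T, h.comul_one]
  have h₄ : (adL mul S).lTensor H (adL mul S x) =
      (i₁ * slot₂ H (slot₁ H P * slot₂ H P * slot₁ H Q) * i₁').ofConv x
        (one ⊗ₜ[k] (one ⊗ₜ[k] one)) := by
    simp only [conv₃_apply (R := i₁'), i₁, i₁', slot₁_tmul, slot₂_tmul, ← h.adL_eq, P, Q]
    simp only [lm_apply, h.mul_one, LinearMap.id_apply, ← LinearMap.lTensor_tmul]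
    rw [adL_apply mul S x]
    simp only [sw₃, sw₂, map_sw]
  rw [h₄]
  have h₅ := ((h₁.mul h₂).mul h₃) x (one ⊗ₜ[k] one)
  rw [← h.adL_eq, hT] at h₅
  refine h₅.trans ?_
  simp only [slot₂_mul, mul_assoc, i₁, i₂, i₃, i₁', i₂']

theorem adL_comul (x : H) : (Coalgebra.comul (R := k) (A := H)).lTensor H (adL mul S x) =
    sw₂ k x fun x₁ x₂ => sw (adL mul S x₁) fun x₁' x₁₀ => sw (adL mul S x₂) fun x₂' x₂₀ =>
      mul x₁' x₂' ⊗ₜ[k] (x₁₀ ⊗ₜ[k] x₂₀) := by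
  let P : ConvEnd k H H := lm mul .id
  let Q : ConvEnd k H H := lm mul S
  let i₁ : ConvEnd k H (H ⊗[k] (H ⊗[k] H)) := slot₁ (H ⊗[k] H) P
  let i₁' : ConvEnd k H (H ⊗[k] (H ⊗[k] H)) := slot₁ (H ⊗[k] H) Q
  let i₂ : ConvEnd k H (H ⊗[k] (H ⊗[k] H)) := slot₂ H (slot₁ H P)
  let i₃ : ConvEnd k H (H ⊗[k] (H ⊗[k] H)) := slot₂ H (slot₂ H P)
  let T : H ⊗[k] H →ₗ[k] H ⊗[k] (H ⊗[k] H) := (Coalgebra.comul (R := k) (A := H)).lTensor H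
  have h₁ : Intertwines T (slot₁ H P) i₁ := by
    intro a t
    induction t with
    | zero => simp
    | tmul b c => simp only [T, slot₁_tmul, LinearMap.lTensor_tmul, i₁]
    | add b c hb hc => simp only [map_add, hb, hc]
  have h₁' : Intertwines T (slot₁ H Q) i₁' := by
    intro a t
    induction t with
    | zero => simp
    | tmul b c => simp only [T, slot₁_tmul, LinearMap.lTensor_tmul, i₁']
    | add b c hb hc => simp only [map_add, hb, hc]
  have h₂ : Intertwines T (slot₂ H P) (i₂ * i₃) := by
    intro a t
    induction t with
    | zero => simp
    | tmul b c =>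
      simp only [T, slot₂_tmul, LinearMap.lTensor_tmul]
      rw [h.intertwines_comul a c, ← slot₂_tmul, slot₂_mul]
    | add b c hb hc => simp only [map_add, hb, hc]
  have h₃ := ((h₁.mul h₂).mul h₁') x (one ⊗ₜ[k] one)
  rw [← h.adL_eq] at h₃
  refine h₃.trans ?_
  have h₄ : i₁ * (i₂ * i₃) * i₁' = (i₁ * i₂ * i₁') * (i₁ * i₃ * i₁') := by
    have : i₁' * i₁ = 1 := slot₁_mul_eq_one h.antipode_mul
    simp only [mul_assoc]
    rw [← mul_assoc i₁' i₁, this, one_mul]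
  have h₅ : ∀ a b c d, (i₁ * i₂ * i₁').ofConv a (b ⊗ₜ[k] (c ⊗ₜ[k] d)) =
      sw (adL mul S a) fun a' a₀ => mul a' b ⊗ₜ[k] (mul a₀ c ⊗ₜ[k] d) := by
    intro a b c d
    have := sw_adL mul S a ((TensorProduct.mk k H (H ⊗[k] H)).compl₁₂ (mul.flip b)
      ((TensorProduct.mk k H H).flip d ∘ₗ mul.flip c))
    simp only [LinearMap.compl₁₂_apply, LinearMap.flip_apply, LinearMap.comp_apply,
      TensorProduct.mk_apply] at this
    simp only [this, conv₃_apply, i₁, i₂, i₁', slot₁_tmul, slot₂_tmul, P, Q, lm_apply,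
      LinearMap.id_apply, h.mul_assoc]
  have h₆ : ∀ a b c d, (i₁ * i₃ * i₁').ofConv a (b ⊗ₜ[k] (c ⊗ₜ[k] d)) =
      sw (adL mul S a) fun a' a₀ => mul a' b ⊗ₜ[k] (c ⊗ₜ[k] mul a₀ d) := by
    intro a b c d
    have := sw_adL mul S a ((TensorProduct.mk k H (H ⊗[k] H)).compl₁₂ (mul.flip b)
      (TensorProduct.mk k H H c ∘ₗ mul.flip d))
    simp only [LinearMap.compl₁₂_apply, LinearMap.flip_apply, LinearMap.comp_apply,
      TensorProduct.mk_apply] at this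
    simp only [this, conv₃_apply, i₁, i₃, i₁', slot₁_tmul, slot₂_tmul, P, Q, lm_apply,
      LinearMap.id_apply, h.mul_assoc]
  have hT : T (one ⊗ₜ[k] one) = one ⊗ₜ[k] (one ⊗ₜ[k] one) := by
    simp [T, h.comul_one]
  rw [h₄, hT, conv_apply]
  simp only [h₆, map_sw, h₅, h.mul_one]
  simp only [sw₂]
  congr 1
  funext a b
  exact sw_comm _ _ _

theorem lm_flip_antipode_mul : lm mul.flip S * lm mul.flip (S ∘ₗ S) = 1 := by
  refine ConvEnd.ext fun x v => ?_
  have := congrArg (fun z => mul v (S z)) (h.mul_S x)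
  simpa only [sw₂, map_sw, map_smul, h.S_mul_rev, h.S_one, h.mul_one, ← h.mul_assoc, conv_apply,
    conv_one_apply, lm_apply, LinearMap.flip_apply, LinearMap.comp_apply] using this

theorem lm_flip_mul_antipode : lm mul.flip (S ∘ₗ S) * lm mul.flip S = 1 := by
  refine ConvEnd.ext fun x v => ?_
  have := congrArg (fun z => mul v (S z)) (h.S_mul x)
  simpa only [sw₂, map_sw, map_smul, h.S_mul_rev, h.S_one, h.mul_one, ← h.mul_assoc, conv_apply,
    conv_one_apply, lm_apply, LinearMap.flip_apply, LinearMap.comp_apply] using this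

/-- The adjoint coaction of a product: `Ad(x y) = x₁ y' S(x₃) ⊗ x₂ y₀`. -/
theorem intertwines_adL : Intertwines (adL mul S) (lm mul .id)
    (slot₁ H (lm mul .id) * slot₂ H (lm mul .id) * slot₁ H (lm mul.flip S)) := by
  let m := tensorHom mul h.comul_mul h.counit_mul
  intro x y
  have h₁ : adL mul S (mul x y) = (pull m (slot₁ H (lm mul .id) * slot₂ H (lm mul .id) *
      slot₁ H (lm mul S))).ofConv (x ⊗ₜ[k] y) (one ⊗ₜ[k] one) := h.adL_eq (mul x y)
  refine h₁.trans ?_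
  rw [pull_mul, pull_mul, conv₃_tmul, conv₃_apply, adL_apply]
  simp only [pull_apply, m, tensorHom_tmul, slot₁_tmul, slot₂_tmul, lm_apply, LinearMap.id_apply,
    h.mul_one, h.S_mul_rev, sw₃, sw₂, map_sw, LinearMap.flip_apply, h.mul_assoc]

end

end IsHopf
end Hopf
/-! ### The Hopf algebra of a Yetter-Drinfeld post-Hopf algebra -/

section Bullet

variable {k : Type u} [Field k] {A : PHData.{u, v} k}

/-- The axioms of a Yetter-Drinfeld post-Hopf algebra on which the Hopf algebra structure of
`(H, •, 1, Δ, ε, S_⇀)` depends, that is all of them but the compatibility of `Δ` with `S_⇀` and the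
symmetry condition on `⇀` and `↼`. -/
structure IsYDPrePostHopf (A : PHData.{u, v} k) : Prop extends IsPrePostHopf A where
  counit_mul : ∀ x y, Coalgebra.counit (R := k) (A.mul x y) =
    Coalgebra.counit (R := k) x * Coalgebra.counit (R := k) y
  counit_one : Coalgebra.counit (R := k) A.one = 1
  comul_one : Coalgebra.comul (R := k) A.one = A.one ⊗ₜ[k] A.one
  comul_mul : ∀ x y, Coalgebra.comul (R := k) (A.mul x y) =
    sw₄ k x fun x₁ x₂ x₃ x₄ => sw₂ k y fun y₁ y₂ =>
      A.mul x₁ (A.act x₂ (A.β x₄ y₁)) ⊗ₜ[k] A.mul x₃ y₂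

theorem IsYDPostHopf.toIsYDPrePostHopf (h : IsYDPostHopf A) : IsYDPrePostHopf A where
  __ := h

/-- `β` as an element of the convolution algebra. -/
noncomputable def PHData.βc (A : PHData.{u, v} k) : ConvEnd k A.H A.H := Ring.inverse A.α

theorem PHData.α_apply (x y : A.H) : A.α.ofConv x y = A.act x y := rfl

theorem PHData.βc_apply (x y : A.H) : A.βc.ofConv x y = A.β x y := rfl

theorem PHData.bullet_eq (A : PHData.{u, v} k) : lm A.bullet .id = lm A.mul .id * A.α :=
  ConvEnd.ext fun x y => by
    rw [conv_apply]
    exact A.bullet_apply x y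

/-- The right-hand side of the formula for `Δ(x · y)` as a word. -/
theorem PHData.twistedComul_eq (A : PHData.{u, v} k) (x y : A.H) :
    (slot₁ A.H (lm A.mul .id) * slot₁ A.H A.α * slot₂ A.H (lm A.mul .id) *
      slot₁ A.H A.βc).ofConv x (Coalgebra.comul (R := k) y) =
    sw₄ k x fun x₁ x₂ x₃ x₄ => sw₂ k y fun y₁ y₂ =>
      A.mul x₁ (A.act x₂ (A.β x₄ y₁)) ⊗ₜ[k] A.mul x₃ y₂ := by
  rw [mul_assoc, mul_assoc, ← mul_assoc (slot₁ A.H A.α), apply_tensor_eq_sw]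
  simp only [conv_apply (slot₁ A.H (lm A.mul .id)), conv₃_apply, slot₁_tmul, slot₂_tmul,
    A.α_apply, A.βc_apply, lm_apply, LinearMap.id_apply]
  simp only [sw₂, map_sw, sw₄, sw₃, slot₁_tmul, lm_apply, LinearMap.id_apply]
  rw [sw_comm (Coalgebra.comul y)]
  congr 1
  funext x₁ x'
  rw [sw_comm (Coalgebra.comul y)]
  congr 1
  funext x₂ x'
  rw [sw_comm (Coalgebra.comul y)]

namespace IsPrePostHopf

variable (h : IsPrePostHopf A)
include h

theorem α_mul_β : A.α * A.βc = 1 := Ring.mul_inverse_cancel _ h.isUnit_α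

theorem β_mul_α : A.βc * A.α = 1 := Ring.inverse_mul_cancel _ h.isUnit_α

theorem act_bullet (x y z : A.H) : A.act (A.bullet x y) z = A.act x (A.act y z) := by
  rw [h.act_act, A.bullet_apply]

theorem intertwines_act : Intertwines (Coalgebra.comul (R := k)) A.α
    (slot₁ A.H A.α * slot₂ A.H A.α) := by
  intro x y
  rw [apply_tensor_eq_sw]
  simp only [conv_apply, slot₁_tmul, slot₂_tmul, A.α_apply]
  exact (h.comul_act x y).trans (sw_comm _ _ _)

/-- The idempotent `x ↦ x ⇀ 1` is convolution invertible, because it is a coalgebra morphism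
followed by the identity of `(H, ·)`, which has the inverse `S`. -/
theorem act_one (h₁ : Coalgebra.counit (R := k) A.one = 1)
    (h₂ : Coalgebra.comul (R := k) A.one = A.one ⊗ₜ[k] A.one) (x : A.H) :
    A.act x A.one = Coalgebra.counit (R := k) x • A.one := by
  let φ : A.H →ₗc[k] A.H :=
    { __ := A.act.flip A.one
      counit_comp := by
        ext x
        simp [h.counit_act, h₁]
      map_comp_comul := by
        ext x
        simp only [LinearMap.comp_apply, LinearMap.flip_apply, h.comul_act, sw₂, h₂]
        have : ∀ a b, sw (A.one ⊗ₜ[k] A.one) (fun c d => A.act a c ⊗ₜ[k] A.act b d) =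
            A.act a A.one ⊗ₜ[k] A.act b A.one := fun a b =>
          sw_tmul A.one A.one ((TensorProduct.mk k A.H A.H).compl₁₂ (A.act a) (A.act b))
        simp only [this]
        exact apply_eq_sw _ _ }
  have e₁ : pull φ (lm A.mul A.S) * pull φ (lm A.mul .id) = 1 := by
    rw [← pull_mul, h.toIsAlg.lm_antipode_mul_lm h.toIsAntipode, pull_one]
  have e₂ : pull φ (lm A.mul .id) * pull φ (lm A.mul .id) = pull φ (lm A.mul .id) := by
    refine ConvEnd.ext fun x v => ?_
    have := congrArg (fun z => A.mul z v) (h.act_mul x A.one A.one)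
    simp only [sw₂, map_sw, sw_apply, h.one_mul, h.mul_assoc] at this
    rw [conv_apply]
    exact this.symm
  have e₃ : pull φ (lm A.mul .id) = 1 := by
    have := congrArg (pull φ (lm A.mul A.S) * ·) e₂
    simpa only [← mul_assoc, e₁, one_mul] using this
  have := congrArg (fun P : ConvEnd k A.H A.H => P.ofConv x A.one) e₃
  rw [conv_one_apply] at this
  rw [← this]
  exact (h.mul_one _).symm

theorem bullet_one (h₁ : Coalgebra.counit (R := k) A.one = 1)
    (h₂ : Coalgebra.comul (R := k) A.one = A.one ⊗ₜ[k] A.one) (x : A.H) :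
    A.bullet x A.one = x := by
  have : (lm A.mul .id * (1 : ConvEnd k A.H A.H)).ofConv x A.one = A.bullet x A.one := by
    simp only [A.bullet_apply, conv_apply, conv_one_apply, h.act_one h₁ h₂, lm_apply,
      LinearMap.id_apply]
  rw [← this, mul_one]
  exact h.mul_one x

theorem one_act (h₁ : Coalgebra.counit (R := k) A.one = 1)
    (h₂ : Coalgebra.comul (R := k) A.one = A.one ⊗ₜ[k] A.one) (x : A.H) :
    A.act A.one x = x := by
  have e : ∀ v, A.β A.one (A.act A.one v) = v := fun v => by
    have := congrArg (fun P : ConvEnd k A.H A.H => P.ofConv A.one v) h.β_mul_α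
    simpa only [conv_apply_of_comul h₂, conv_one_apply, h₁, one_smul, A.α_apply, A.βc_apply]
      using this
  have := congrArg (A.β A.one) (h.act_bullet A.one A.one x)
  rwa [h.bullet_one h₁ h₂, e, e, eq_comm] at this

end IsPrePostHopf

namespace IsYDPrePostHopf

variable (h : IsYDPrePostHopf A)
include h

theorem intertwines_mul : Intertwines (Coalgebra.comul (R := k)) (lm A.mul .id)
    (slot₁ A.H (lm A.mul .id) * slot₁ A.H A.α * slot₂ A.H (lm A.mul .id) * slot₁ A.H A.βc) :=
  fun x y => (h.comul_mul x y).trans (A.twistedComul_eq x y).symm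

/-- Multiplying the words for `·` and `⇀`, the inner factors `β` and `α` cancel. -/
theorem intertwines_bullet : Intertwines (Coalgebra.comul (R := k)) (lm A.bullet .id)
    (slot₁ A.H (lm A.bullet .id) * slot₂ A.H (lm A.bullet .id)) := by
  have e := h.intertwines_mul.mul h.intertwines_act
  have : slot₁ A.H A.βc * (slot₁ A.H A.α * slot₂ A.H A.α) = slot₂ A.H A.α := by
    rw [← mul_assoc, slot₁_mul_eq_one h.β_mul_α, one_mul]
  rwa [← A.bullet_eq, mul_assoc, this, mul_assoc, ← slot₂_mul, ← slot₁_mul, ← A.bullet_eq] at e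

theorem comul_bullet (x y : A.H) : Coalgebra.comul (R := k) (A.bullet x y) =
    sw₂ k x fun x₁ x₂ => sw₂ k y fun y₁ y₂ => A.bullet x₁ y₁ ⊗ₜ[k] A.bullet x₂ y₂ := by
  have e := h.intertwines_bullet x y
  rw [apply_tensor_eq_sw] at e
  simp only [conv_apply, slot₁_tmul, slot₂_tmul, lm_apply, LinearMap.id_apply] at e
  exact e.trans (sw_comm _ _ _)

theorem counit_bullet (x y : A.H) : Coalgebra.counit (R := k) (A.bullet x y) =
    Coalgebra.counit (R := k) x * Coalgebra.counit (R := k) y := by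
  have e₁ : Intertwines (Coalgebra.counit (R := k)) (lm A.mul .id) 1 := by
    intro x y
    rw [conv_one_apply, smul_eq_mul]
    exact h.counit_mul x y
  have e₂ : Intertwines (Coalgebra.counit (R := k)) A.α 1 := by
    intro x y
    rw [conv_one_apply, smul_eq_mul]
    exact h.counit_act x y
  have := (e₁.mul e₂) x y
  rwa [← A.bullet_eq, one_mul, conv_one_apply, smul_eq_mul] at this

/-- The product `•` as a coalgebra morphism `H ⊗ H → H`. -/
noncomputable abbrev bulletHom : A.H ⊗[k] A.H →ₗc[k] A.H :=
  tensorHom A.bullet h.comul_bullet h.counit_bullet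

/-- The action `⇀` as a coalgebra morphism `H ⊗ H → H`. -/
noncomputable abbrev actHom : A.H ⊗[k] A.H →ₗc[k] A.H :=
  tensorHom A.act h.comul_act h.counit_act

/-- Both sides are `∑ (x₁ • y₁) · (x₂ ⇀ (y₂ ⇀ z))`. -/
theorem bullet_assoc (x y z : A.H) :
    A.bullet (A.bullet x y) z = A.bullet x (A.bullet y z) := by
  have e₁ : A.bullet (A.bullet x y) z = sw₂ k x fun x₁ x₂ => sw₂ k y fun y₁ y₂ =>
      A.mul (A.bullet x₁ y₁) (A.act x₂ (A.act y₂ z)) := by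
    have : A.bullet (A.bullet x y) z =
        (pull h.bulletHom (lm A.mul .id * A.α)).ofConv (x ⊗ₜ[k] y) z := by
      rw [← A.bullet_eq]
      rfl
    rw [this, pull_mul, conv_tmul]
    simp only [pull_apply, tensorHom_tmul, lm_apply, LinearMap.id_apply, A.α_apply, h.act_bullet]
  have e₂ : ∀ y z, A.bullet x (A.mul y z) =
      sw₂ k x fun x₁ x₂ => A.mul (A.bullet x₁ y) (A.act x₂ z) := by
    intro y z
    have : (lm A.mul .id * lm A.mul (A.act.flip y) * A.α).ofConv x z =
        A.bullet x (A.mul y z) := by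
      rw [mul_assoc, A.bullet_apply, conv_apply]
      simp only [h.act_mul, conv_apply, lm_apply, LinearMap.id_apply, A.α_apply,
        LinearMap.flip_apply]
    rw [← this, conv_apply]
    simp only [conv_apply, lm_apply, LinearMap.id_apply, A.α_apply, LinearMap.flip_apply,
      A.bullet_apply, sw₂, map_sw, sw_apply, h.mul_assoc]
  rw [e₁, A.bullet_apply y z]
  simp only [sw₂, map_sw, e₂]
  exact sw_comm _ _ _

theorem one_bullet (x : A.H) : A.bullet A.one x = x := by
  have : A.bullet A.one x = (lm A.mul .id * A.α).ofConv A.one x := by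
    rw [← A.bullet_eq]
    rfl
  rw [this, conv_apply_of_comul h.comul_one]
  exact (h.one_mul _).trans (h.one_act h.counit_one h.comul_one x)

theorem isAlg_bullet : IsAlg A.bullet A.one where
  mul_assoc := h.bullet_assoc
  one_mul := h.one_bullet
  mul_one := h.bullet_one h.counit_one h.comul_one

theorem bullet_subS (x : A.H) : (sw₂ k x fun x₁ x₂ => A.bullet x₁ (A.subS x₂)) =
    Coalgebra.counit (R := k) x • A.one := by
  have e₁ : A.subS = cact A.βc A.S := rfl
  have e₂ := cact_apply (lm A.bullet .id) A.subS x
  rw [e₁, ← mul_cact, A.bullet_eq, mul_assoc, h.α_mul_β, mul_one, ← A.bullet_eq, ← e₁,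
    cact_apply] at e₂
  exact e₂.symm.trans (h.mul_S x)

/-- Left multiplication by `•` is the product of the invertible words for `·` and `α`, so that the
right inverse coming from `S_⇀` is two-sided. -/
theorem isHopf_bullet : IsHopf A.bullet A.one A.subS where
  toIsAlg := h.isAlg_bullet
  toIsAntipode := by
    have e₁ : lm A.bullet .id * lm A.bullet A.subS = 1 := by
      refine ConvEnd.ext fun x v => ?_
      have := congrArg (fun z => A.bullet z v) (h.bullet_subS x)
      simpa only [sw₂, map_sw, sw_apply, map_smul, LinearMap.smul_apply, h.one_bullet,
        h.bullet_assoc, conv_apply, conv_one_apply, lm_apply, LinearMap.id_apply] using this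
    have e₂ : A.βc * lm A.mul A.S * lm A.bullet .id = 1 := by
      rw [A.bullet_eq]
      exact mul_mul_eq_one h.β_mul_α (h.toIsAlg.lm_antipode_mul_lm h.toIsAntipode)
    refine h.isAlg_bullet.isAntipode_of_lm e₁ ?_
    rwa [left_inv_eq_right_inv e₂ e₁] at e₂
  comul_mul := h.comul_bullet
  comul_one := h.comul_one
  counit_mul := h.counit_bullet
  counit_one := h.counit_one

theorem act_subS (x y : A.H) : A.act (A.subS x) y = A.β x y := by
  have e : A.α * (WithConv.toConv (A.act ∘ₗ A.subS) : ConvEnd k A.H A.H) = 1 := by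
    refine ConvEnd.ext fun x v => ?_
    have := congrArg (fun z => A.act z v) (h.bullet_subS x)
    simpa only [sw₂, map_sw, sw_apply, map_smul, LinearMap.smul_apply, h.act_bullet, conv_apply,
      conv_one_apply, h.one_act h.counit_one h.comul_one, A.α_apply, LinearMap.comp_apply]
      using this
  have := congrArg (fun P : ConvEnd k A.H A.H => P.ofConv x y)
    (left_inv_eq_right_inv h.β_mul_α e)
  exact this.symm

end IsYDPrePostHopf
end Bullet
/-! ### From Yetter-Drinfeld post-Hopf algebras to relative Rota-Baxter operators -/

section IdObj

variable {k : Type u} [Field k] {A : PHData.{u, v} k}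

namespace IsYDPrePostHopf

variable (h : IsYDPrePostHopf A)
include h

/-- The words `S_⇀(T) m`, with `T = ⇀` and `m = •`, over the coalgebra `H ⊗ H`. -/
theorem ract_eq (x y v : A.H) : A.bullet (A.ract x y) v =
    (pull h.actHom (lm A.bullet A.subS) * pull h.bulletHom (lm A.bullet .id)).ofConv
      (x ⊗ₜ[k] y) v := by
  simp only [PHData.ract, conv_tmul, sw₂, map_sw, sw_apply, h.bullet_assoc, pull_apply,
    tensorHom_tmul, lm_apply, LinearMap.id_apply]

/-- The symmetry condition on `⇀` and `↼`, written out in terms of `•` and `S_⇀`. -/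
theorem symmetric_iff (x y : A.H) :
    ((sw₃ k x fun a₁ a₂ a₃ => sw₃ k y fun b₁ b₂ b₃ =>
      A.bullet (A.bullet (A.subS (A.act a₁ b₁)) a₂) b₂ ⊗ₜ[k] A.act a₃ b₃) =
    sw₃ k x fun a₁ a₂ a₃ => sw₃ k y fun b₁ b₂ b₃ =>
      A.bullet (A.bullet (A.subS (A.act a₂ b₂)) a₃) b₃ ⊗ₜ[k] A.act a₁ b₁) ↔
    (sw₂ k x fun x₁ x₂ => sw₂ k y fun y₁ y₂ => A.act x₁ y₁ ⊗ₜ[k] A.ract x₂ y₂) =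
      sw₂ k x fun x₁ x₂ => sw₂ k y fun y₁ y₂ => A.act x₂ y₂ ⊗ₜ[k] A.ract x₁ y₁ := by
  have hH := h.isHopf_bullet
  let T : ConvEnd k (A.H ⊗[k] A.H) A.H := pull h.actHom (lm A.bullet .id)
  let T' : ConvEnd k (A.H ⊗[k] A.H) A.H := pull h.actHom (lm A.bullet A.subS)
  let m : ConvEnd k (A.H ⊗[k] A.H) A.H := pull h.bulletHom (lm A.bullet .id)
  have hr : ∀ x y, (T' * m).ofConv (x ⊗ₜ[k] y) A.one = A.ract x y := fun x y => by
    rw [← h.ract_eq, hH.mul_one]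
  have hT : ∀ x y, T.ofConv (x ⊗ₜ[k] y) A.one = A.act x y := fun x y => hH.mul_one _
  have e₁ : (sw₃ k x fun a₁ a₂ a₃ => sw₃ k y fun b₁ b₂ b₃ =>
      A.bullet (A.bullet (A.subS (A.act a₁ b₁)) a₂) b₂ ⊗ₜ[k] A.act a₃ b₃) =
      TensorProduct.comm k A.H A.H (sw₂ k x fun x₁ x₂ => sw₂ k y fun y₁ y₂ =>
        A.act x₂ y₂ ⊗ₜ[k] A.ract x₁ y₁) := by
    have e₂ := conv₃_tmul (slot₁ A.H T') (slot₁ A.H m) (slot₂ A.H T) x y (A.one ⊗ₜ[k] A.one)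
    rw [← slot₁_mul, conv_tmul] at e₂
    simp only [slot₁_tmul, slot₂_tmul, hr, hT] at e₂
    simp only [← LinearEquiv.coe_coe, sw₂, map_sw] at e₂ ⊢
    refine Eq.trans ?_ e₂.symm
    simp only [T', m, pull_apply, tensorHom_tmul, lm_apply, LinearMap.id_apply, hH.mul_assoc,
      hH.mul_one]
  have e₂ : (sw₃ k x fun a₁ a₂ a₃ => sw₃ k y fun b₁ b₂ b₃ =>
      A.bullet (A.bullet (A.subS (A.act a₂ b₂)) a₃) b₃ ⊗ₜ[k] A.act a₁ b₁) =
      TensorProduct.comm k A.H A.H (sw₂ k x fun x₁ x₂ => sw₂ k y fun y₁ y₂ =>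
        A.act x₁ y₁ ⊗ₜ[k] A.ract x₂ y₂) := by
    have e₂ := conv₃_tmul (slot₂ A.H T) (slot₁ A.H T') (slot₁ A.H m) x y (A.one ⊗ₜ[k] A.one)
    rw [mul_assoc, ← slot₁_mul, conv_tmul] at e₂
    simp only [slot₁_tmul, slot₂_tmul, hr, hT] at e₂
    simp only [← LinearEquiv.coe_coe, sw₂, map_sw] at e₂ ⊢
    refine Eq.trans ?_ e₂.symm
    simp only [T', m, pull_apply, tensorHom_tmul, lm_apply, LinearMap.id_apply, hH.mul_assoc,
      hH.mul_one]
  rw [e₁, e₂, (TensorProduct.comm k A.H A.H).injective.eq_iff, eq_comm]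

end IsYDPrePostHopf

namespace IsYDPostHopf

variable (h : IsYDPostHopf A)
include h

/-- With `T = ⇀` and `m = •` as coalgebra morphisms on `H ⊗ H`, the symmetry condition says that
`T₂` commutes with `T₁⁻¹ m₁`, where the subscripts refer to the factors of the target `H ⊗ H`.
Hence `T₁ T₂ T₁⁻¹ = m₁ T₂ m₁⁻¹`, which is the compatibility of action and coaction
`Ad(x ⇀ y) = x₁ y' S(x₃) ⊗ (x₂ ⇀ y₀)`. -/
theorem intertwines_adL_act : Intertwines (adL A.bullet A.subS) A.α
    (slot₁ A.H (lm A.bullet .id) * slot₂ A.H A.α * slot₁ A.H (lm A.bullet.flip A.subS)) := by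
  have h' := h.toIsYDPrePostHopf
  have hH := h'.isHopf_bullet
  let T₁ := slot₁ A.H (pull h'.actHom (lm A.bullet .id))
  let T₁' := slot₁ A.H (pull h'.actHom (lm A.bullet A.subS))
  let T₂ := slot₂ A.H (pull h'.actHom (lm A.bullet .id))
  let m₁ := slot₁ A.H (pull h'.bulletHom (lm A.bullet .id))
  let m₁' := slot₁ A.H (pull h'.bulletHom (lm A.bullet A.subS))
  have hT : T₁ * T₁' = 1 :=
    slot₁_mul_eq_one (by rw [← pull_mul, hH.mul_antipode, pull_one])
  have hm : m₁ * m₁' = 1 :=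
    slot₁_mul_eq_one (by rw [← pull_mul, hH.mul_antipode, pull_one])
  have hcomm : T₂ * (T₁' * m₁) = T₁' * m₁ * T₂ := by
    rw [← slot₁_mul]
    refine ConvEnd.ext fun t s => ?_
    induction t with
    | zero => simp only [map_zero, LinearMap.zero_apply]
    | add a b ha hb => simp only [map_add, LinearMap.add_apply, ha, hb]
    | tmul x y =>
      induction s with
      | zero => simp only [map_zero]
      | add a b ha hb => simp only [map_add, ha, hb]
      | tmul v w =>
        let M : A.H ⊗[k] A.H →ₗ[k] A.H ⊗[k] A.H := TensorProduct.lift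
          ((TensorProduct.mk k A.H A.H).compl₁₂ (A.bullet.flip v) (A.bullet.flip w)).flip
        have hM : ∀ a b, M (a ⊗ₜ[k] b) = A.bullet b v ⊗ₜ[k] A.bullet a w := fun a b => by
          simp [M]
        have e := congrArg M (h.act_ract x y)
        simp only [sw₂, map_sw, hM, h'.ract_eq] at e
        simpa only [conv_tmul (slot₂ A.H _), conv_tmul _ (slot₂ A.H _), T₂, sw₂, slot₁_tmul,
          slot₂_tmul, pull_apply, tensorHom_tmul, lm_apply, LinearMap.id_apply] using e
  have key : T₁ * T₂ * T₁' = m₁ * T₂ * m₁' := by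
    calc T₁ * T₂ * T₁' = T₁ * (T₂ * (T₁' * m₁)) * m₁' := by simp only [mul_assoc, hm, mul_one]
      _ = T₁ * T₁' * (m₁ * T₂ * m₁') := by rw [hcomm]; simp only [mul_assoc]
      _ = m₁ * T₂ * m₁' := by rw [hT, one_mul]
  intro x y
  have e₁ : adL A.bullet A.subS (A.act x y) =
      (T₁ * T₂ * T₁').ofConv (x ⊗ₜ[k] y) (A.one ⊗ₜ[k] A.one) := by
    have e : T₁ * T₂ * T₁' = pull h'.actHom (slot₁ A.H (lm A.bullet .id) *
        slot₂ A.H (lm A.bullet .id) * slot₁ A.H (lm A.bullet A.subS)) := by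
      rw [pull_mul, pull_mul]
      rfl
    rw [e]
    exact hH.adL_eq _
  refine e₁.trans ?_
  rw [key, conv₃_tmul, conv₃_apply, adL_apply]
  simp only [m₁, m₁', T₂, pull_apply, tensorHom_tmul, slot₁_tmul, slot₂_tmul, lm_apply,
    LinearMap.id_apply, hH.mul_one, hH.S_mul_rev, sw₃, sw₂, map_sw, LinearMap.flip_apply,
    hH.mul_assoc, A.α_apply]

/-- Left multiplication by `·` is the product of left multiplication by `•` and `β`, so the formula
for `Ad(x · y)` is the quotient of those for `Ad(x • y)` and `Ad(x ⇀ y)`. -/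
theorem intertwines_adL_mul : Intertwines (adL A.bullet A.subS) (lm A.mul .id)
    (slot₁ A.H (lm A.bullet .id) * slot₂ A.H (lm A.mul .id) *
      slot₁ A.H (lm A.bullet A.subS)) := by
  have h' := h.toIsYDPrePostHopf
  have hH := h'.isHopf_bullet
  have e₁ : lm A.bullet .id * A.βc = lm A.mul .id := by
    rw [A.bullet_eq, mul_assoc, h.α_mul_β, mul_one]
  have e₂ := h.intertwines_adL_act.inv h.α_mul_β
    (Q' := slot₁ A.H (lm A.bullet.flip (A.subS ∘ₗ A.subS)) *
      (slot₂ A.H A.βc * slot₁ A.H (lm A.bullet A.subS))) (by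
      rw [mul_assoc (slot₁ A.H (lm A.bullet .id))]
      rw [mul_assoc, mul_assoc, ← mul_assoc (slot₁ A.H (lm A.bullet A.subS)),
        slot₁_mul_eq_one hH.antipode_mul, one_mul, ← mul_assoc (slot₂ A.H A.βc),
        slot₂_mul_eq_one h.β_mul_α, one_mul, slot₁_mul_eq_one hH.lm_flip_mul_antipode])
  have e₃ := hH.intertwines_adL.mul e₂
  rwa [e₁, mul_assoc _ (slot₁ A.H (lm A.bullet.flip A.subS)),
    ← mul_assoc (slot₁ A.H (lm A.bullet.flip A.subS)),
    slot₁_mul_eq_one hH.lm_flip_antipode_mul, one_mul, ← mul_assoc,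
    mul_assoc _ (slot₂ A.H (lm A.bullet .id)), ← slot₂_mul, e₁] at e₃

theorem isYDBimonoid : IsYDBimonoid A.bullet A.one A.subS A.mul A.one A.act
    (adL A.bullet A.subS) where
  mul_assoc := h.mul_assoc
  one_mul := h.one_mul
  mul_one := h.mul_one
  one_act := h.one_act h.counit_one h.comul_one
  mul_act := h.act_bullet
  act_mul := h.act_mul
  act_one := h.act_one h.counit_one h.comul_one
  comul_act := h.comul_act
  counit_act := h.counit_act
  coact_coassoc := h.toIsYDPrePostHopf.isHopf_bullet.adL_coassoc
  coact_counit := h.toIsYDPrePostHopf.isHopf_bullet.adL_counit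
  coact_act a x := by
    have hH := h.toIsYDPrePostHopf.isHopf_bullet
    refine (h.intertwines_adL_act a x).trans ?_
    rw [apply_tensor_eq_sw]
    simp only [conv₃_apply, slot₁_tmul, slot₂_tmul, lm_apply, LinearMap.id_apply,
      LinearMap.flip_apply, A.α_apply, hH.mul_assoc]
    exact sw_sw₃_comm _ _ _
  coact_mul x y := by
    have hH := h.toIsYDPrePostHopf.isHopf_bullet
    refine (h.intertwines_adL_mul x y).trans ?_
    rw [apply_tensor_eq_sw, sw_comm]
    congr 1
    funext y' y₀
    have := sw_adL A.bullet A.subS x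
      ((TensorProduct.mk k A.H A.H).compl₁₂ (A.bullet.flip y') (A.mul.flip y₀))
    simp only [LinearMap.compl₁₂_apply, LinearMap.flip_apply, TensorProduct.mk_apply,
      hH.mul_assoc] at this
    rw [this, conv₃_apply]
    simp only [slot₁_tmul, slot₂_tmul, lm_apply, LinearMap.id_apply]
  coact_one := h.toIsYDPrePostHopf.isHopf_bullet.adL_one
  coact_comul := h.toIsYDPrePostHopf.isHopf_bullet.adL_comul
  coact_counit_colinear := h.toIsYDPrePostHopf.isHopf_bullet.adL_counit_right
  comul_mul x y := by
    have e : ∀ x₁ x₂ y₁ y₂, (sw (adL A.bullet A.subS x₂) fun x₂' x₂₀ =>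
        A.mul x₁ (A.act x₂' y₁) ⊗ₜ[k] A.mul x₂₀ y₂) = sw₃ k x₂ fun x₂ x₃ x₄ =>
          A.mul x₁ (A.act x₂ (A.β x₄ y₁)) ⊗ₜ[k] A.mul x₃ y₂ := by
      intro x₁ x₂ y₁ y₂
      have := sw_adL A.bullet A.subS x₂ ((TensorProduct.mk k A.H A.H).compl₁₂
        (A.mul x₁ ∘ₗ A.act.flip y₁) (A.mul.flip y₂))
      simp only [LinearMap.compl₁₂_apply, LinearMap.flip_apply, TensorProduct.mk_apply,
        LinearMap.comp_apply, h.act_bullet, h.toIsYDPrePostHopf.act_subS] at this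
      exact this
    rw [h.comul_mul, sw₄, sw₂, sw₂]
    congr 1
    funext x₁ x'
    simp only [e]
    exact (sw_sw₃_comm _ _ _).symm
  comul_one := h.comul_one
  counit_mul := h.counit_mul
  counit_one := h.counit_one

theorem act_subS_mul (f : A.H →ₗ[k] A.H) (hf : ∀ a, f a = a) (a : A.H) :
    (sw₃ k a fun a₁ a₂ a₃ => A.mul (A.act a₁ (f (A.subS a₂))) (f a₃)) =
      Coalgebra.counit (R := k) a • A.one := by
  have e₁ : cact A.α A.subS = A.S := by
    have : A.subS = cact A.βc A.S := rfl
    rw [this, ← mul_cact, h.α_mul_β, one_cact]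
  have e₂ := sw₂_sw₂_left a ((A.act.compl₂ A.subS).compr₂ A.mul)
  simp only [LinearMap.compr₂_apply, LinearMap.compl₂_apply] at e₂
  have e₃ : ∀ a b, (sw₂ k a fun a₁ a₂ => A.mul (A.act a₁ (A.subS a₂)) b) = A.mul (A.S a) b := by
    intro a b
    rw [← e₁, cact_apply]
    simp only [sw₂, map_sw, sw_apply, A.α_apply]
  simp only [e₃] at e₂
  simp only [hf]
  exact e₂.symm.trans (h.S_mul a)

theorem isYDRelRB_idObj : IsYDRelRB (idObj A) where
  hopf := h.toIsYDPrePostHopf.isHopf_bullet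
  bimonoid := h.isYDBimonoid
  rotaBaxter := A.bullet_apply
  symmetric a b := (h.toIsYDPrePostHopf.symmetric_iff a b).2 (h.act_ract a b)
  bijective := Function.bijective_id
  inverse := h.act_subS_mul _ ((idObj A).R_Rinv Function.bijective_id)

theorem isD_idObj : isD k ⟨idObj A, h.isYDRelRB_idObj⟩ := by
  have : (idObj A).Rinv h.isYDRelRB_idObj.bijective = LinearMap.id :=
    LinearMap.ext fun a => (idObj A).R_Rinv h.isYDRelRB_idObj.bijective a
  have e : adL A.bullet A.subS = LinearMap.id.lTensor A.H ∘ₗ adL A.bullet A.subS := by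
    rw [LinearMap.lTensor_id, LinearMap.id_comp]
  exact e.trans (congrArg (fun f : A.H →ₗ[k] A.H => f.lTensor A.H ∘ₗ adL A.bullet A.subS) this.symm)

end IsYDPostHopf
end IdObj
/-! ### From relative Rota-Baxter operators to Yetter-Drinfeld post-Hopf algebras -/

section Transport

variable {k : Type u} [Field k]

namespace RelData

variable (X : RelData.{u, v} k) (hR : Function.Bijective X.R)

theorem Rinv_R (b : X.K) : X.Rinv hR (X.R b) = b := hR.1 (X.R_Rinv hR _)

/-- The inverse of `R` as a coalgebra morphism. -/
noncomputable def RinvHom : X.H →ₗc[k] X.K where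
  __ := X.Rinv hR
  counit_comp := by
    ext a
    have := CoalgHomClass.counit_comp_apply X.R (X.Rinv hR a)
    rw [X.R_Rinv hR] at this
    exact this.symm
  map_comp_comul := by
    have e : (X.R : X.K →ₗ[k] X.H) ∘ₗ X.Rinv hR = LinearMap.id :=
      LinearMap.ext (X.R_Rinv hR)
    have e' : X.Rinv hR ∘ₗ (X.R : X.K →ₗ[k] X.H) = LinearMap.id :=
      LinearMap.ext (X.Rinv_R hR)
    have h : TensorProduct.map (X.R : X.K →ₗ[k] X.H) (X.R : X.K →ₗ[k] X.H) ∘ₗ Coalgebra.comul =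
      Coalgebra.comul ∘ₗ (X.R : X.K →ₗ[k] X.H) := X.R.map_comp_comul
    calc TensorProduct.map (X.Rinv hR) (X.Rinv hR) ∘ₗ Coalgebra.comul
        = TensorProduct.map (X.Rinv hR) (X.Rinv hR) ∘ₗ
          (Coalgebra.comul ∘ₗ (X.R : X.K →ₗ[k] X.H)) ∘ₗ X.Rinv hR := by
          rw [LinearMap.comp_assoc, e, LinearMap.comp_id]
      _ = TensorProduct.map (X.Rinv hR ∘ₗ (X.R : X.K →ₗ[k] X.H))
            (X.Rinv hR ∘ₗ (X.R : X.K →ₗ[k] X.H)) ∘ₗ Coalgebra.comul ∘ₗ X.Rinv hR := by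
          rw [← h, TensorProduct.map_comp]
          rfl
      _ = Coalgebra.comul ∘ₗ X.Rinv hR := by
          rw [e', TensorProduct.map_id, LinearMap.id_comp]

theorem RinvHom_apply (a : X.H) : X.RinvHom hR a = X.Rinv hR a := rfl

theorem comul_Rinv (a : X.H) : Coalgebra.comul (R := k) (X.Rinv hR a) =
    TensorProduct.map (X.Rinv hR) (X.Rinv hR) (Coalgebra.comul (R := k) a) :=
  (CoalgHomClass.map_comp_comul_apply (X.RinvHom hR) a).symm

theorem counit_Rinv (a : X.H) : Coalgebra.counit (R := k) (X.Rinv hR a) =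
    Coalgebra.counit (R := k) a :=
  CoalgHomClass.counit_comp_apply (X.RinvHom hR) a

theorem comul_R (b : X.K) : Coalgebra.comul (R := k) (X.R b) =
    TensorProduct.map (X.R : X.K →ₗ[k] X.H) (X.R : X.K →ₗ[k] X.H) (Coalgebra.comul (R := k) b) :=
  (CoalgHomClass.map_comp_comul_apply X.R b).symm

theorem counit_R (b : X.K) : Coalgebra.counit (R := k) (X.R b) = Coalgebra.counit (R := k) b :=
  CoalgHomClass.counit_comp_apply X.R b

theorem R_sw {V W : Type*} [AddCommGroup V] [Module k V] [AddCommGroup W] [Module k W]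
    (t : V ⊗[k] W) (f : V → W → X.K) : X.R (sw t f) = sw t fun x y => X.R (f x y) :=
  map_sw (X.R : X.K →ₗ[k] X.H) t f

theorem sw₂_Rinv {U : Type*} [AddCommGroup U] [Module k U] (a : X.H)
    (F : X.K →ₗ[k] X.K →ₗ[k] U) : (sw₂ k (X.Rinv hR a) fun x y => F x y) =
      sw₂ k a fun x y => F (X.Rinv hR x) (X.Rinv hR y) := by
  rw [sw₂, X.comul_Rinv hR, sw_map, sw₂]

/-- The map `a ↦ a₁ ⇀ R⁻¹ S(a₂)`. -/
noncomputable def convAct : X.H →ₗ[k] X.K :=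
  TensorProduct.lift (X.act.compl₂ (X.Rinv hR ∘ₗ X.SH)) ∘ₗ Coalgebra.comul

theorem convAct_apply (a : X.H) : X.convAct hR a =
    sw₂ k a fun a₁ a₂ => X.act a₁ (X.Rinv hR (X.SH a₂)) :=
  (sw_eq_lift (Coalgebra.comul (R := k) a) (X.act.compl₂ (X.Rinv hR ∘ₗ X.SH))).symm

theorem mulK_convAct_Rinv (x : X.H) :
    (sw₂ k x fun x' x₃ => X.mulK (X.convAct hR x') (X.Rinv hR x₃)) =
      sw₃ k x fun a₁ a₂ a₃ => X.mulK (X.act a₁ (X.Rinv hR (X.SH a₂))) (X.Rinv hR a₃) := by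
  have e := sw₂_sw₂_left x (LinearMap.compr₂ (X.act.compl₂ (X.Rinv hR ∘ₗ X.SH))
    (X.mulK.compl₂ (X.Rinv hR)))
  simp only [LinearMap.compr₂_apply, LinearMap.compl₂_apply, LinearMap.comp_apply] at e
  simpa only [X.convAct_apply, sw₂, map_sw, sw_apply] using e

end RelData

/-- Bijective operators satisfying the Rota-Baxter identity on a module algebra and module coalgebra
over a Hopf algebra. -/
structure IsBijRelRB (X : RelData.{u, v} k) : Prop where
  hopf : IsHopf X.mulH X.oneH X.SH
  alg : IsAlg X.mulK X.oneK
  moduleAlgCoalg : IsModuleAlgCoalg X.mulH X.oneH X.mulK X.oneK X.act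
  rotaBaxter : X.RotaBaxter
  bijective : Function.Bijective X.R

theorem IsYDRelRB.isBijRelRB {X : RBData.{u, v} k} (h : IsYDRelRB X) :
    IsBijRelRB X.toRelData where
  hopf := h.hopf
  alg := h.bimonoid.toIsAlg
  moduleAlgCoalg := h.bimonoid.toIsModuleAlgCoalg
  rotaBaxter := h.rotaBaxter
  bijective := h.bijective

theorem IsCocommBijRB.isBijRelRB {X : RelData.{u, v} k} (h : IsCocommBijRB X) :
    IsBijRelRB X where
  hopf := h.hopfH
  alg := h.hopfK.choose_spec.toIsAlg
  moduleAlgCoalg := h.moduleBialgebra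
  rotaBaxter := h.rotaBaxter
  bijective := h.bijective

namespace IsBijRelRB

variable {X : RelData.{u, v} k} (h : IsBijRelRB X)
include h

theorem mulH_R (a : X.H) (b : X.K) : X.mulH a (X.R b) =
    X.R (sw₂ k a fun a₁ a₂ => X.mulK (X.Rinv h.bijective a₁) (X.act a₂ b)) := by
  have e := h.rotaBaxter (X.Rinv h.bijective a) b
  have e₂ := X.sw₂_Rinv h.bijective a
    ((LinearMap.mul k (Module.End k X.K)).compl₁₂ X.mulK (X.act ∘ₗ (X.R : X.K →ₗ[k] X.H)))
  have e₃ := congrArg (fun f : Module.End k X.K => f b) e₂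
  simp only [sw₂, sw_apply, LinearMap.compl₁₂_apply, LinearMap.mul_apply', Module.End.mul_apply,
    LinearMap.comp_apply, CoalgHom.coe_toLinearMap, X.R_Rinv] at e₃
  rw [X.R_Rinv] at e
  rw [e]
  exact congrArg X.R e₃

/-- The element `R⁻¹(1)` is a left unit, by the Rota-Baxter identity. -/
theorem Rinv_one : X.Rinv h.bijective X.oneH = X.oneK := by
  have e := h.mulH_R X.oneH X.oneK
  have e' := sw_tmul X.oneH X.oneH (X.mulK.compl₁₂ (X.Rinv h.bijective) (X.act.flip X.oneK))
  simp only [LinearMap.compl₁₂_apply, LinearMap.flip_apply] at e'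
  rw [sw₂, h.hopf.comul_one, e'] at e
  simp only [h.moduleAlgCoalg.one_act,
    h.hopf.one_mul, h.alg.mul_one] at e
  exact (h.bijective.1 e).symm

theorem R_one : X.R X.oneK = X.oneH := by
  rw [← h.Rinv_one, X.R_Rinv]

theorem mulK_convAct (x : X.H) :
    (sw₂ k x fun x₁ x₂ => X.mulK (X.Rinv h.bijective x₁) (X.convAct h.bijective x₂)) =
      Coalgebra.counit (R := k) x • X.oneK := by
  apply h.bijective.1
  have e := sw₂_sw₂_left x (LinearMap.compr₂ ((LinearMap.mul k (Module.End k X.K)).compl₁₂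
    (X.mulK ∘ₗ X.Rinv h.bijective) X.act) (LinearMap.lcomp k X.K (X.Rinv h.bijective ∘ₗ X.SH)))
  simp only [LinearMap.compr₂_apply, LinearMap.compl₁₂_apply, LinearMap.mul_apply',
    LinearMap.lcomp_apply, Module.End.mul_apply, LinearMap.comp_apply] at e
  simp only [X.convAct_apply, sw₂, sw₃, map_sw] at e ⊢
  rw [← e]
  have e₂ := fun a b => h.mulH_R a (X.Rinv h.bijective b)
  simp only [X.R_Rinv, sw₂] at e₂
  have e₃ := h.hopf.mul_S x
  simp only [e₂, sw₂] at e₃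
  rw [map_smul, h.R_one, ← e₃]
  simp only [X.R_sw]

theorem transport_mul_assoc (x y z : X.H) : X.R (X.mulK (X.Rinv h.bijective (X.R (X.mulK
    (X.Rinv h.bijective x) (X.Rinv h.bijective y)))) (X.Rinv h.bijective z)) =
    X.R (X.mulK (X.Rinv h.bijective x) (X.Rinv h.bijective (X.R (X.mulK
    (X.Rinv h.bijective y) (X.Rinv h.bijective z))))) := by
  simp only [X.Rinv_R, h.alg.mul_assoc]

theorem transport_one_mul (x : X.H) :
    X.R (X.mulK (X.Rinv h.bijective X.oneH) (X.Rinv h.bijective x)) = x := by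
  rw [h.Rinv_one, h.alg.one_mul, X.R_Rinv]

theorem transport_mul_one (x : X.H) :
    X.R (X.mulK (X.Rinv h.bijective x) (X.Rinv h.bijective X.oneH)) = x := by
  rw [h.Rinv_one, h.alg.mul_one, X.R_Rinv]

theorem transport_isAlg : IsAlg (transportObj X h.bijective).mul
    (transportObj X h.bijective).one where
  mul_assoc := h.transport_mul_assoc
  one_mul := h.transport_one_mul
  mul_one := h.transport_mul_one

theorem transport_mul_S (x : X.H) :
    (sw₂ k x fun x₁ x₂ => X.R (X.mulK (X.Rinv h.bijective x₁)
      (X.Rinv h.bijective (X.R (X.convAct h.bijective x₂))))) =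
      Coalgebra.counit (R := k) x • X.oneH := by
  have := congrArg X.R (h.mulK_convAct x)
  rw [map_smul, h.R_one, sw₂, X.R_sw] at this
  simpa only [X.Rinv_R, sw₂] using this

theorem transport_S_mul (hi : ∀ a : X.H, (sw₃ k a fun a₁ a₂ a₃ =>
      X.mulK (X.act a₁ (X.Rinv h.bijective (X.SH a₂))) (X.Rinv h.bijective a₃)) =
    Coalgebra.counit (R := k) a • X.oneK) (x : X.H) :
    (sw₂ k x fun x₁ x₂ => X.R (X.mulK (X.Rinv h.bijective (X.R (X.convAct h.bijective x₁)))
      (X.Rinv h.bijective x₂))) = Coalgebra.counit (R := k) x • X.oneH := by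
  have e := congrArg X.R ((X.mulK_convAct_Rinv h.bijective x).trans (hi x))
  rw [map_smul, h.R_one, sw₂, X.R_sw] at e
  simpa only [X.Rinv_R, sw₂] using e

theorem transport_comul_act (a x : X.H) :
    Coalgebra.comul (R := k) (X.R (X.act a (X.Rinv h.bijective x))) =
      sw₂ k a fun a₁ a₂ => sw₂ k x fun x₁ x₂ =>
        X.R (X.act a₁ (X.Rinv h.bijective x₁)) ⊗ₜ[k] X.R (X.act a₂ (X.Rinv h.bijective x₂)) := by
  have e : ∀ a₁ a₂, (sw₂ k (X.Rinv h.bijective x) fun x₁ x₂ => X.act a₁ x₁ ⊗ₜ[k] X.act a₂ x₂) =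
      sw₂ k x fun x₁ x₂ => X.act a₁ (X.Rinv h.bijective x₁) ⊗ₜ[k]
        X.act a₂ (X.Rinv h.bijective x₂) := fun a₁ a₂ =>
    X.sw₂_Rinv h.bijective x ((TensorProduct.mk k X.K X.K).compl₁₂ (X.act a₁) (X.act a₂))
  rw [X.comul_R, h.moduleAlgCoalg.comul_act]
  simp only [e]
  simp only [sw₂, map_sw, TensorProduct.map_tmul, CoalgHom.coe_toLinearMap]

theorem transport_counit_act (a x : X.H) :
    Coalgebra.counit (R := k) (X.R (X.act a (X.Rinv h.bijective x))) =
      Coalgebra.counit (R := k) a * Coalgebra.counit (R := k) x := by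
  rw [X.counit_R, h.moduleAlgCoalg.counit_act, X.counit_Rinv]

theorem transport_act_mul (a x y : X.H) :
    X.R (X.act a (X.Rinv h.bijective (X.R (X.mulK (X.Rinv h.bijective x)
      (X.Rinv h.bijective y))))) =
      sw₂ k a fun a₁ a₂ => X.R (X.mulK
        (X.Rinv h.bijective (X.R (X.act a₁ (X.Rinv h.bijective x))))
        (X.Rinv h.bijective (X.R (X.act a₂ (X.Rinv h.bijective y))))) := by
  rw [X.Rinv_R, h.moduleAlgCoalg.act_mul, sw₂, X.R_sw]
  simp only [X.Rinv_R, sw₂]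

/-- For the transported structure, `•` is the product of `H`; this is the Rota-Baxter identity. -/
theorem transport_mulH (x y : X.H) :
    (sw₂ k x fun x₁ x₂ => X.R (X.mulK (X.Rinv h.bijective x₁)
      (X.Rinv h.bijective (X.R (X.act x₂ (X.Rinv h.bijective y)))))) = X.mulH x y := by
  have := h.mulH_R x (X.Rinv h.bijective y)
  rw [X.R_Rinv, sw₂, X.R_sw] at this
  simpa only [X.Rinv_R, sw₂] using this.symm

theorem transport_bullet (x y : X.H) : (transportObj X h.bijective).bullet x y = X.mulH x y :=
  ((transportObj X h.bijective).bullet_apply x y).trans (h.transport_mulH x y)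

theorem transport_act_mulH (x y z : X.H) :
    X.R (X.act (X.mulH x y) (X.Rinv h.bijective z)) =
      X.R (X.act x (X.Rinv h.bijective (X.R (X.act y (X.Rinv h.bijective z))))) := by
  rw [X.Rinv_R, h.moduleAlgCoalg.mul_act]

/-- The transported action as a map into the endomorphisms of `H`. -/
noncomputable def transportAct : X.H →ₗ[k] Module.End k X.H :=
  (X.act.compl₂ (X.Rinv h.bijective)).compr₂ (X.R : X.K →ₗ[k] X.H)

theorem transportAct_apply (x y : X.H) :
    h.transportAct x y = X.R (X.act x (X.Rinv h.bijective y)) := rfl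

theorem transportAct_mulH (x y z : X.H) :
    h.transportAct (X.mulH x y) z = h.transportAct x (h.transportAct y z) :=
  h.transport_act_mulH x y z

theorem transportAct_one (x : X.H) : h.transportAct X.oneH x = x := by
  rw [h.transportAct_apply, h.moduleAlgCoalg.one_act, X.R_Rinv]

theorem transportAct_mul_antipode : (WithConv.toConv h.transportAct : ConvEnd k X.H X.H) *
    WithConv.toConv (h.transportAct ∘ₗ X.SH) = 1 := by
  refine ConvEnd.ext fun x v => ?_
  have := congrArg (fun a => h.transportAct a v) (h.hopf.mul_S x)
  simpa only [sw₂, map_sw, sw_apply, map_smul, LinearMap.smul_apply, h.transportAct_mulH,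
    h.transportAct_one, conv_apply, conv_one_apply, LinearMap.comp_apply] using this

theorem transportAct_antipode_mul : (WithConv.toConv (h.transportAct ∘ₗ X.SH) :
    ConvEnd k X.H X.H) * WithConv.toConv h.transportAct = 1 := by
  refine ConvEnd.ext fun x v => ?_
  have := congrArg (fun a => h.transportAct a v) (h.hopf.S_mul x)
  simpa only [sw₂, map_sw, sw_apply, map_smul, LinearMap.smul_apply, h.transportAct_mulH,
    h.transportAct_one, conv_apply, conv_one_apply, LinearMap.comp_apply] using this

theorem transport_isUnit : IsUnit (transportObj X h.bijective).α :=
  isUnit_iff_exists.2 ⟨_, h.transportAct_mul_antipode, h.transportAct_antipode_mul⟩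

theorem transport_β (x y : X.H) :
    (transportObj X h.bijective).β x y = h.transportAct (X.SH x) y := by
  have e : (transportObj X h.bijective).βc = WithConv.toConv (h.transportAct ∘ₗ X.SH) :=
    left_inv_eq_right_inv (Ring.inverse_mul_cancel _ h.transport_isUnit)
      h.transportAct_mul_antipode
  exact congrArg (fun P : ConvEnd k X.H X.H => P.ofConv x y) e

theorem transport_isPrePostHopf (hi : ∀ a : X.H, (sw₃ k a fun a₁ a₂ a₃ =>
      X.mulK (X.act a₁ (X.Rinv h.bijective (X.SH a₂))) (X.Rinv h.bijective a₃)) =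
    Coalgebra.counit (R := k) a • X.oneK) : IsPrePostHopf (transportObj X h.bijective) where
  toIsAlg := h.transport_isAlg
  mul_S := h.transport_mul_S
  S_mul := h.transport_S_mul hi
  comul_act := h.transport_comul_act
  counit_act := h.transport_counit_act
  act_mul := h.transport_act_mul
  act_act x y z := (h.transport_act_mulH x y z).symm.trans
    (congrArg (fun a => h.transportAct a z) (h.transport_mulH x y).symm)
  isUnit_α := h.transport_isUnit

/-- `S_⇀` for the transported structure is the antipode of `H`:
`S(x₁) ⇀ (x₂ ⇀ S(x₃)) = S(x)`. -/
theorem transport_subS (x : X.H) : (transportObj X h.bijective).subS x = X.SH x := by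
  have e₀ : ∀ x : X.H, X.R (X.convAct h.bijective x) =
      cact (WithConv.toConv h.transportAct : ConvEnd k X.H X.H) X.SH x := by
    intro x
    rw [cact_apply, X.convAct_apply]
    simp only [sw₂, X.R_sw, h.transportAct_apply]
  have e₁ : (transportObj X h.bijective).S =
      cact (WithConv.toConv h.transportAct : ConvEnd k X.H X.H) X.SH := LinearMap.ext e₀
  have e₂ : (transportObj X h.bijective).βc = WithConv.toConv (h.transportAct ∘ₗ X.SH) :=
    left_inv_eq_right_inv (Ring.inverse_mul_cancel _ h.transport_isUnit)
      h.transportAct_mul_antipode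
  have e₃ : (transportObj X h.bijective).subS =
      cact (transportObj X h.bijective).βc (transportObj X h.bijective).S := rfl
  have e₄ : cact (WithConv.toConv (h.transportAct ∘ₗ X.SH) : ConvEnd k X.H X.H)
      (cact (WithConv.toConv h.transportAct : ConvEnd k X.H X.H) X.SH) = X.SH := by
    rw [← mul_cact, h.transportAct_antipode_mul, one_cact]
  rw [e₃, e₁, e₂]
  exact LinearMap.congr_fun e₄ x

end IsBijRelRB
end Transport
section TransportYD

variable {k : Type u} [Field k]

namespace RelData

variable (X : RelData.{u, v} k)

/-- Left multiplication by `R(R(a) ⇀ b)`, as a map on the coalgebra `K ⊗ K`. -/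
noncomputable def actWord : ConvEnd k (X.K ⊗[k] X.K) X.H :=
  lm X.mulH (TensorProduct.lift
    ((X.act.comp (X.R : X.K →ₗ[k] X.H)).compr₂ (X.R : X.K →ₗ[k] X.H)))

/-- Left multiplication by `S R(R(a) ⇀ b)`, as a map on the coalgebra `K ⊗ K`. -/
noncomputable def actInvWord : ConvEnd k (X.K ⊗[k] X.K) X.H :=
  lm X.mulH (X.SH ∘ₗ TensorProduct.lift
    ((X.act.comp (X.R : X.K →ₗ[k] X.H)).compr₂ (X.R : X.K →ₗ[k] X.H)))

/-- Left multiplication by `R(a) R(b)`, as a map on the coalgebra `K ⊗ K`. -/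
noncomputable def mulWord : ConvEnd k (X.K ⊗[k] X.K) X.H :=
  lm X.mulH (TensorProduct.lift
    (X.mulH.compl₁₂ (X.R : X.K →ₗ[k] X.H) (X.R : X.K →ₗ[k] X.H)))

theorem actWord_tmul (a b : X.K) (v : X.H) :
    X.actWord.ofConv (a ⊗ₜ[k] b) v = X.mulH (X.R (X.act (X.R a) b)) v := rfl

theorem actInvWord_tmul (a b : X.K) (v : X.H) :
    X.actInvWord.ofConv (a ⊗ₜ[k] b) v = X.mulH (X.SH (X.R (X.act (X.R a) b))) v := rfl

theorem mulWord_tmul (a b : X.K) (v : X.H) :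
    X.mulWord.ofConv (a ⊗ₜ[k] b) v = X.mulH (X.mulH (X.R a) (X.R b)) v := rfl

/-- The symmetry condition on a relative Rota-Baxter operator as an equation between words. -/
theorem symmetric_iff (h : IsHopf X.mulH X.oneH X.SH) (a b : X.K) :
    ((sw₃ k a fun a₁ a₂ a₃ => sw₃ k b fun b₁ b₂ b₃ =>
      X.mulH (X.mulH (X.SH (X.R (X.act (X.R a₁) b₁))) (X.R a₂)) (X.R b₂) ⊗ₜ[k]
        X.R (X.act (X.R a₃) b₃)) =
    sw₃ k a fun a₁ a₂ a₃ => sw₃ k b fun b₁ b₂ b₃ =>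
      X.mulH (X.mulH (X.SH (X.R (X.act (X.R a₂) b₂))) (X.R a₃)) (X.R b₃) ⊗ₜ[k]
        X.R (X.act (X.R a₁) b₁)) ↔
    (slot₁ X.H X.actInvWord * slot₁ X.H X.mulWord * slot₂ X.H X.actWord).ofConv (a ⊗ₜ[k] b)
      (X.oneH ⊗ₜ[k] X.oneH) =
    (slot₂ X.H X.actWord * slot₁ X.H X.actInvWord * slot₁ X.H X.mulWord).ofConv (a ⊗ₜ[k] b)
      (X.oneH ⊗ₜ[k] X.oneH) := by
  rw [conv₃_tmul, conv₃_tmul]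
  simp only [slot₁_tmul, slot₂_tmul, X.actWord_tmul, X.actInvWord_tmul, X.mulWord_tmul, h.mul_one,
    h.mul_assoc]

end RelData

namespace IsYDRelRB

variable {X : RBData.{u, v} k} (h : IsYDRelRB X)
include h

/-- The twisted bialgebra axiom on `K`, carried over to `H` along `R`. -/
theorem transport_comul_mul (hD : isD k ⟨X, h⟩) (x y : X.H) :
    Coalgebra.comul (R := k) (X.R (X.mulK (X.Rinv h.bijective x) (X.Rinv h.bijective y))) =
      sw₄ k x fun x₁ x₂ x₃ x₄ => sw₂ k y fun y₁ y₂ =>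
        X.R (X.mulK (X.Rinv h.bijective x₁) (X.act (X.mulH x₂ (X.SH x₄)) (X.Rinv h.bijective y₁)))
          ⊗ₜ[k] X.R (X.mulK (X.Rinv h.bijective x₃) (X.Rinv h.bijective y₂)) := by
  let ρ := X.Rinv h.bijective
  let P : ConvEnd k X.K (X.K ⊗[k] X.K) := slot₁ X.K (lm X.mulK .id)
  let G₀ : X.H →ₗ[k] X.K →ₗ[k] Module.End k (X.K ⊗[k] X.K) :=
    (TensorProduct.mapBilinear (.id k) X.K X.K X.K X.K).compl₁₂ X.act X.mulK
  let G : ConvEnd k X.K (X.K ⊗[k] X.K) :=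
    WithConv.toConv (TensorProduct.lift G₀ ∘ₗ X.coact)
  have hG : ∀ c v w, G.ofConv c (v ⊗ₜ[k] w) =
      sw (X.coact c) fun a d => X.act a v ⊗ₜ[k] X.mulK d w := by
    intro c v w
    have e : G.ofConv c = sw (X.coact c) fun a d => G₀ a d :=
      (sw_eq_lift (X.coact c) G₀).symm
    rw [e, sw_apply]
    rfl
  have hG' : ∀ c v w, G.ofConv (ρ c) (v ⊗ₜ[k] w) =
      sw₃ k c fun c₁ c₂ c₃ => X.act (X.mulH c₁ (X.SH c₃)) v ⊗ₜ[k] X.mulK (ρ c₂) w := by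
    intro c v w
    have e₁ : X.coact (ρ c) = TensorProduct.map LinearMap.id ρ (adL X.mulH X.SH c) := by
      have := LinearMap.congr_fun hD (ρ c)
      refine this.trans ?_
      exact congrArg (fun a => (ρ.lTensor X.H) (adL X.mulH X.SH a)) (X.R_Rinv h.bijective c)
    have e₂ := sw_map LinearMap.id ρ (adL X.mulH X.SH c)
      ((TensorProduct.mk k X.K X.K).compl₁₂ (X.act.flip v) (X.mulK.flip w))
    have e₃ := sw_adL X.mulH X.SH c
      ((TensorProduct.mk k X.K X.K).compl₁₂ (X.act.flip v) ((X.mulK.flip w) ∘ₗ ρ))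
    simp only [LinearMap.compl₁₂_apply, LinearMap.flip_apply, LinearMap.comp_apply,
      TensorProduct.mk_apply, LinearMap.id_apply] at e₂ e₃
    rw [hG, e₁, e₂, e₃]
  have e₁ : Coalgebra.comul (R := k) (X.mulK (ρ x) (ρ y)) =
      (P * G).ofConv (ρ x) (TensorProduct.map ρ ρ (Coalgebra.comul (R := k) y)) := by
    rw [h.bimonoid.comul_mul, ← X.comul_Rinv h.bijective, apply_tensor_eq_sw]
    simp only [conv_apply, hG, P, sw₂, map_sw, slot₁_tmul, lm_apply, LinearMap.id_apply]
    exact sw_comm _ _ _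
  have e₂ : (P * G).ofConv (ρ x) =
      (pull (X.RinvHom h.bijective) P * pull (X.RinvHom h.bijective) G).ofConv x := by
    rw [← pull_mul]
    rfl
  rw [X.comul_R, e₁, e₂, apply_eq_sw (TensorProduct.map ρ ρ)]
  simp only [map_sw, TensorProduct.map_tmul, conv_apply, pull_apply, X.RinvHom_apply]
  simp only [ρ] at hG'
  simp only [hG', P, ρ, sw₃, sw₄, sw₂, map_sw, slot₁_tmul, lm_apply, LinearMap.id_apply,
    TensorProduct.map_tmul, CoalgHom.coe_toLinearMap]
  rw [sw_comm (Coalgebra.comul y)]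
  congr 1
  funext x₁ x'
  rw [sw_comm (Coalgebra.comul y)]
  congr 1
  funext x₂ x''
  rw [sw_comm (Coalgebra.comul y)]

theorem transport_counit_mul (x y : X.H) :
    Coalgebra.counit (R := k) (X.R (X.mulK (X.Rinv h.bijective x) (X.Rinv h.bijective y))) =
      Coalgebra.counit (R := k) x * Coalgebra.counit (R := k) y := by
  rw [X.counit_R, h.bimonoid.counit_mul, X.counit_Rinv, X.counit_Rinv]

theorem transport_isYDPrePostHopf (hD : isD k ⟨X, h⟩) :
    IsYDPrePostHopf (transportObj X.toRelData h.bijective) where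
  toIsPrePostHopf := h.isBijRelRB.transport_isPrePostHopf h.inverse
  counit_mul := h.transport_counit_mul
  counit_one := h.hopf.counit_one
  comul_one := h.hopf.comul_one
  comul_mul x y := by
    refine (h.transport_comul_mul hD x y).trans ?_
    have e : ∀ x₁ x₂ x₃ x₄ y₁ y₂ : X.H,
        X.R (X.mulK (X.Rinv h.bijective x₁) (X.act (X.mulH x₂ (X.SH x₄)) (X.Rinv h.bijective y₁)))
          ⊗ₜ[k] X.R (X.mulK (X.Rinv h.bijective x₃) (X.Rinv h.bijective y₂)) =
        (transportObj X.toRelData h.bijective).mul x₁ ((transportObj X.toRelData h.bijective).act x₂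
          ((transportObj X.toRelData h.bijective).β x₄ y₁)) ⊗ₜ[k]
            (transportObj X.toRelData h.bijective).mul x₃ y₂ := by
      intro x₁ x₂ x₃ x₄ y₁ y₂
      rw [h.isBijRelRB.transport_β]
      have e := h.isBijRelRB.transportAct_mulH x₂ (X.SH x₄) y₁
      have e₂ := congrArg (fun a => X.R (X.mulK (X.Rinv h.bijective x₁) (X.Rinv h.bijective a))) e
      rw [h.isBijRelRB.transportAct_apply, X.Rinv_R] at e₂
      exact congrArg (· ⊗ₜ[k] X.R (X.mulK (X.Rinv h.bijective x₃) (X.Rinv h.bijective y₂))) e₂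
    simp only [e]
    rfl

/-- The symmetry condition carried over to `H` along `R`. -/
theorem transport_symmetric (x y : X.H) :
    (sw₃ k x fun a₁ a₂ a₃ => sw₃ k y fun b₁ b₂ b₃ =>
      X.mulH (X.mulH (X.SH (X.R (X.act a₁ (X.Rinv h.bijective b₁)))) a₂) b₂ ⊗ₜ[k]
        X.R (X.act a₃ (X.Rinv h.bijective b₃))) =
    sw₃ k x fun a₁ a₂ a₃ => sw₃ k y fun b₁ b₂ b₃ =>
      X.mulH (X.mulH (X.SH (X.R (X.act a₂ (X.Rinv h.bijective b₂)))) a₃) b₃ ⊗ₜ[k]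
        X.R (X.act a₁ (X.Rinv h.bijective b₁)) := by
  let ρ := X.RinvHom h.bijective
  let φ : X.H ⊗[k] X.H →ₗc[k] X.K ⊗[k] X.K := Coalgebra.TensorProduct.map ρ ρ
  have hφ : ∀ a b, φ (a ⊗ₜ[k] b) = X.Rinv h.bijective a ⊗ₜ[k] X.Rinv h.bijective b :=
    fun _ _ => rfl
  have e := (X.symmetric_iff h.hopf _ _).1
    (h.symmetric (X.Rinv h.bijective x) (X.Rinv h.bijective y))
  rw [← hφ, ← pull_apply, ← pull_apply, pull_mul, pull_mul, pull_mul, pull_mul, conv₃_tmul,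
    conv₃_tmul] at e
  simpa only [pull_apply, hφ, slot₁_tmul, slot₂_tmul, X.actWord_tmul, X.actInvWord_tmul,
    X.mulWord_tmul, h.hopf.mul_one, h.hopf.mul_assoc, X.R_Rinv] using e

theorem transport_isYDPostHopf (hD : isD k ⟨X, h⟩) :
    IsYDPostHopf (transportObj X.toRelData h.bijective) where
  __ := h.transport_isYDPrePostHopf hD
  comul_subS x := by
    have e := h.hopf.comul_S x
    have e₂ : (transportObj X.toRelData h.bijective).subS = X.SH :=
      LinearMap.ext h.isBijRelRB.transport_subS
    rw [e₂]
    exact e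
  act_ract x y := by
    refine ((h.transport_isYDPrePostHopf hD).symmetric_iff x y).1 ?_
    have e₁ : (transportObj X.toRelData h.bijective).bullet = X.mulH :=
      LinearMap.ext fun x => LinearMap.ext (h.isBijRelRB.transport_bullet x)
    have e₂ : (transportObj X.toRelData h.bijective).subS = X.SH :=
      LinearMap.ext h.isBijRelRB.transport_subS
    rw [e₁, e₂]
    exact h.transport_symmetric x y

end IsYDRelRB
end TransportYD
/-! ### The cocommutative case -/

section CocommPostHopf

variable {k : Type u} [Field k] {A : PHData.{u, v} k}

/-- In the cocommutative case `α` and `β` cancel in the twisted formula for `Δ(x · y)`. -/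
theorem IsPrePostHopf.twistedComul_of_isCocomm (h : IsPrePostHopf A)
    [Coalgebra.IsCocomm k A.H] (x y : A.H) :
    (sw₄ k x fun x₁ x₂ x₃ x₄ => sw₂ k y fun y₁ y₂ =>
      A.mul x₁ (A.act x₂ (A.β x₄ y₁)) ⊗ₜ[k] A.mul x₃ y₂) =
    sw₂ k x fun x₁ x₂ => sw₂ k y fun y₁ y₂ => A.mul x₁ y₁ ⊗ₜ[k] A.mul x₂ y₂ := by
  rw [← A.twistedComul_eq, mul_assoc, ← slot_comm, mul_assoc, ← mul_assoc (slot₁ A.H A.α),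
    slot₁_mul_eq_one h.α_mul_β, one_mul, apply_tensor_eq_sw]
  simp only [conv_apply, slot₁_tmul, slot₂_tmul, lm_apply, LinearMap.id_apply]
  exact sw_comm _ _ _

theorem IsYDPrePostHopf.act_ract_of_isCocomm (h : IsYDPrePostHopf A)
    [Coalgebra.IsCocomm k A.H] (x y : A.H) :
    (sw₂ k x fun x₁ x₂ => sw₂ k y fun y₁ y₂ => A.act x₁ y₁ ⊗ₜ[k] A.ract x₂ y₂) =
      sw₂ k x fun x₁ x₂ => sw₂ k y fun y₁ y₂ => A.act x₂ y₂ ⊗ₜ[k] A.ract x₁ y₁ := by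
  have hH := h.isHopf_bullet
  let T : ConvEnd k (A.H ⊗[k] A.H) A.H := pull h.actHom (lm A.bullet .id)
  let r : ConvEnd k (A.H ⊗[k] A.H) A.H :=
    pull h.actHom (lm A.bullet A.subS) * pull h.bulletHom (lm A.bullet .id)
  have hr : ∀ x y, r.ofConv (x ⊗ₜ[k] y) A.one = A.ract x y := fun x y => by
    rw [← h.ract_eq, hH.mul_one]
  have hT : ∀ x y, T.ofConv (x ⊗ₜ[k] y) A.one = A.act x y := fun x y => hH.mul_one _
  have e := congrArg (fun P : ConvEnd k (A.H ⊗[k] A.H) (A.H ⊗[k] A.H) =>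
    P.ofConv (x ⊗ₜ[k] y) (A.one ⊗ₜ[k] A.one)) (slot_comm T r)
  simpa only [conv_tmul (slot₁ A.H T), conv_tmul (slot₂ A.H r), slot₁_tmul, slot₂_tmul, hr, hT]
    using e

theorem IsCocommPostHopf.isYDPostHopf (h : IsCocommPostHopf A) : IsYDPostHopf A := by
  have := h.cocomm
  have h' : IsYDPrePostHopf A :=
    { toIsPrePostHopf := h.toIsPrePostHopf
      counit_mul := h.counit_mul
      counit_one := h.counit_one
      comul_one := h.comul_one
      comul_mul := fun x y =>
        (h.comul_mul x y).trans (h.toIsPrePostHopf.twistedComul_of_isCocomm x y).symm }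
  exact
    { toIsPrePostHopf := h.toIsPrePostHopf
      counit_mul := h.counit_mul
      counit_one := h.counit_one
      comul_one := h.comul_one
      comul_mul := h'.comul_mul
      comul_subS := h'.isHopf_bullet.comul_S
      act_ract := h'.act_ract_of_isCocomm }

theorem IsYDPostHopf.isCocommPostHopf (h : IsYDPostHopf A) (hc : Coalgebra.IsCocomm k A.H) :
    IsCocommPostHopf A where
  toIsPrePostHopf := h.toIsPrePostHopf
  comul_mul x y := (h.comul_mul x y).trans (h.toIsPrePostHopf.twistedComul_of_isCocomm x y)
  comul_one := h.comul_one
  counit_mul := h.counit_mul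
  counit_one := h.counit_one
  cocomm := hc

end CocommPostHopf

section CocommRB

variable {k : Type u} [Field k] {X : RelData.{u, v} k}

namespace IsBijRelRB

variable (h : IsBijRelRB X)
include h

/-- If `K` has an antipode, the right convolution inverse `a ↦ a₁ ⇀ R⁻¹ S(a₂)` of `R⁻¹` is
two-sided. -/
theorem inverse_of_antipode {SK : X.K →ₗ[k] X.K} (hS : IsAntipode X.mulK X.oneK SK) (a : X.H) :
    (sw₃ k a fun a₁ a₂ a₃ =>
      X.mulK (X.act a₁ (X.Rinv h.bijective (X.SH a₂))) (X.Rinv h.bijective a₃)) =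
    Coalgebra.counit (R := k) a • X.oneK := by
  let ρ := X.RinvHom h.bijective
  let W : ConvEnd k X.H X.K := lm X.mulK (X.convAct h.bijective)
  have e₁ : pull ρ (lm X.mulK SK) * pull ρ (lm X.mulK .id) = 1 := by
    rw [← pull_mul, h.alg.lm_antipode_mul_lm hS, pull_one]
  have e₂ : pull ρ (lm X.mulK .id) * W = 1 := by
    refine ConvEnd.ext fun x v => ?_
    have := congrArg (fun a => X.mulK a v) (h.mulK_convAct x)
    simpa only [sw₂, map_sw, sw_apply, map_smul, LinearMap.smul_apply, h.alg.one_mul,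
      h.alg.mul_assoc, conv_apply, conv_one_apply, lm_apply, W, pull_apply, ρ, X.RinvHom_apply,
      LinearMap.id_apply] using this
  have e₃ : W * pull ρ (lm X.mulK .id) = 1 := by
    rwa [left_inv_eq_right_inv e₁ e₂] at e₁
  have e₄ := congrArg (fun P : ConvEnd k X.H X.K => P.ofConv a X.oneK) e₃
  simp only [conv_apply, conv_one_apply, lm_apply, W, pull_apply, ρ, X.RinvHom_apply,
    LinearMap.id_apply, h.alg.mul_one] at e₄
  rw [← X.mulK_convAct_Rinv]
  exact e₄

theorem isAntipode_convAct (hi : ∀ a : X.H, (sw₃ k a fun a₁ a₂ a₃ =>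
      X.mulK (X.act a₁ (X.Rinv h.bijective (X.SH a₂))) (X.Rinv h.bijective a₃)) =
    Coalgebra.counit (R := k) a • X.oneK) :
    IsAntipode X.mulK X.oneK (X.convAct h.bijective ∘ₗ (X.R : X.K →ₗ[k] X.H)) where
  mul_S b := by
    obtain ⟨x, rfl⟩ : ∃ x, X.Rinv h.bijective x = b := ⟨X.R b, X.Rinv_R _ b⟩
    have e := X.sw₂_Rinv h.bijective x
      (X.mulK.compl₂ (X.convAct h.bijective ∘ₗ (X.R : X.K →ₗ[k] X.H)))
    simp only [LinearMap.compl₂_apply, LinearMap.comp_apply, CoalgHom.coe_toLinearMap,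
      X.R_Rinv] at e ⊢
    rw [e, h.mulK_convAct, X.counit_Rinv]
  S_mul b := by
    obtain ⟨x, rfl⟩ : ∃ x, X.Rinv h.bijective x = b := ⟨X.R b, X.Rinv_R _ b⟩
    have e := X.sw₂_Rinv h.bijective x
      (X.mulK ∘ₗ (X.convAct h.bijective ∘ₗ (X.R : X.K →ₗ[k] X.H)))
    simp only [LinearMap.comp_apply, CoalgHom.coe_toLinearMap, X.R_Rinv] at e ⊢
    rw [e, X.mulK_convAct_Rinv, hi, X.counit_Rinv]

theorem symmetric_of_isCocomm [Coalgebra.IsCocomm k X.K] (x y : X.K) :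
    (sw₃ k x fun a₁ a₂ a₃ => sw₃ k y fun b₁ b₂ b₃ =>
      X.mulH (X.mulH (X.SH (X.R (X.act (X.R a₁) b₁))) (X.R a₂)) (X.R b₂) ⊗ₜ[k]
        X.R (X.act (X.R a₃) b₃)) =
    sw₃ k x fun a₁ a₂ a₃ => sw₃ k y fun b₁ b₂ b₃ =>
      X.mulH (X.mulH (X.SH (X.R (X.act (X.R a₂) b₂))) (X.R a₃)) (X.R b₃) ⊗ₜ[k]
        X.R (X.act (X.R a₁) b₁) := by
  have e : slot₁ X.H X.actInvWord * slot₁ X.H X.mulWord * slot₂ X.H X.actWord =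
      slot₂ X.H X.actWord * slot₁ X.H X.actInvWord * slot₁ X.H X.mulWord := by
    rw [← slot₁_mul, slot_comm, slot₁_mul, mul_assoc]
  exact (X.symmetric_iff h.hopf x y).2 (by rw [e])

end IsBijRelRB

end CocommRB
section TrivialCoaction

variable {k : Type u} [Field k]

/-- For the trivial coaction the braiding is the flip. -/
theorem IsBijRelRB.sw_trivial_coact {X : RelData.{u, v} k} (h : IsBijRelRB X)
    (x₁ x₂ y₁ y₂ : X.K) : (sw (X.oneH ⊗ₜ[k] x₂) fun x₂' x₂₀ =>
      X.mulK x₁ (X.act x₂' y₁) ⊗ₜ[k] X.mulK x₂₀ y₂) = X.mulK x₁ y₁ ⊗ₜ[k] X.mulK x₂ y₂ := by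
  refine (sw_tmul_of_linear X.oneH x₂ (TensorProduct.map (X.mulK x₁ ∘ₗ X.act.flip y₁)
    (X.mulK.flip y₂)) fun _ _ => rfl).trans ?_
  simp only [TensorProduct.map_tmul, LinearMap.comp_apply, LinearMap.flip_apply,
    h.moduleAlgCoalg.one_act]

namespace IsCocommBijRB

variable {X : RelData.{u, v} k} (h : IsCocommBijRB X)
include h

theorem trivial_coact_act (a : X.H) (x : X.K) : X.oneH ⊗ₜ[k] X.act a x =
    sw₃ k a fun a₁ a₂ a₃ => sw (X.oneH ⊗ₜ[k] x) fun x' x₀ =>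
      X.mulH (X.mulH a₁ x') (X.SH a₃) ⊗ₜ[k] X.act a₂ x₀ := by
  have := h.cocommH
  let P : ConvEnd k X.H X.K := WithConv.toConv X.act
  have e : slot₁ X.K (lm X.mulH .id) * slot₂ X.H P * slot₁ X.K (lm X.mulH X.SH) =
      slot₂ X.H P := by
    rw [slot_comm, mul_assoc, slot₁_mul_eq_one h.hopfH.mul_antipode, mul_one]
  have e₁ : ∀ a₁ a₂ a₃, (sw (X.oneH ⊗ₜ[k] x) fun x' x₀ =>
      X.mulH (X.mulH a₁ x') (X.SH a₃) ⊗ₜ[k] X.act a₂ x₀) =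
      X.mulH a₁ (X.SH a₃) ⊗ₜ[k] X.act a₂ x := by
    intro a₁ a₂ a₃
    refine (sw_tmul_of_linear X.oneH x (TensorProduct.map (X.mulH.flip (X.SH a₃) ∘ₗ X.mulH a₁)
      (X.act a₂)) fun _ _ => rfl).trans ?_
    simp only [TensorProduct.map_tmul, LinearMap.comp_apply, LinearMap.flip_apply,
      h.hopfH.mul_one]
  have e₂ := congrArg (fun Q : ConvEnd k X.H (X.H ⊗[k] X.K) => Q.ofConv a (X.oneH ⊗ₜ[k] x)) e
  simp only [conv₃_apply, slot₁_tmul, slot₂_tmul, lm_apply, LinearMap.id_apply,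
    h.hopfH.mul_one] at e₂
  simp only [e₁]
  exact e₂.symm

theorem trivial_isYDBimonoid : IsYDBimonoid X.mulH X.oneH X.SH X.mulK X.oneK X.act
    (TensorProduct.mk k X.H X.K X.oneH) where
  toIsAlg := h.isBijRelRB.alg
  toIsModuleAlgCoalg := h.moduleBialgebra
  coact_coassoc x := by
    simp [h.hopfH.comul_one]
  coact_counit x := by
    rw [TensorProduct.mk_apply, sw_tmul_of_linear X.oneH x (TensorProduct.lid k X.K ∘ₗ
      (Coalgebra.counit (R := k)).rTensor X.K) fun a b => by simp, h.hopfH.counit_one, one_smul]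
  coact_act := h.trivial_coact_act
  coact_mul x y := by
    have e : ∀ x' x₀, (sw (X.oneH ⊗ₜ[k] y) fun y' y₀ => X.mulH x' y' ⊗ₜ[k] X.mulK x₀ y₀) =
        x' ⊗ₜ[k] X.mulK x₀ y := by
      intro x' x₀
      refine (sw_tmul_of_linear X.oneH y (TensorProduct.map (X.mulH x') (X.mulK x₀))
        fun _ _ => rfl).trans ?_
      rw [TensorProduct.map_tmul, h.hopfH.mul_one]
    simp only [TensorProduct.mk_apply, e]
    exact (sw_tmul_of_linear X.oneH x ((X.mulK.flip y).lTensor X.H) fun _ _ => rfl).symm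
  coact_one := rfl
  coact_comul x := by
    have e : ∀ a b : X.K, (sw (X.oneH ⊗ₜ[k] a) fun a' a₀ => sw (X.oneH ⊗ₜ[k] b) fun b' b₀ =>
        X.mulH a' b' ⊗ₜ[k] (a₀ ⊗ₜ[k] b₀)) = X.oneH ⊗ₜ[k] (a ⊗ₜ[k] b) := by
      intro a b
      have e : ∀ (a' : X.H) (a₀ : X.K), (sw (X.oneH ⊗ₜ[k] b) fun b' b₀ =>
          X.mulH a' b' ⊗ₜ[k] (a₀ ⊗ₜ[k] b₀)) = a' ⊗ₜ[k] (a₀ ⊗ₜ[k] b) := by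
        intro a' a₀
        refine (sw_tmul_of_linear X.oneH b
          (TensorProduct.map (X.mulH a') (TensorProduct.mk k X.K X.K a₀)) fun _ _ => rfl).trans ?_
        rw [TensorProduct.map_tmul, h.hopfH.mul_one]
        rfl
      simp only [e]
      exact sw_tmul_of_linear X.oneH a
        (((TensorProduct.mk k X.K X.K).flip b).lTensor X.H) fun _ _ => rfl
    simp only [TensorProduct.mk_apply, e, sw₂, LinearMap.lTensor_tmul]
    exact apply_eq_sw (TensorProduct.mk k X.H _ X.oneH) (Coalgebra.comul (R := k) x)
  coact_counit_colinear x := by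
    rw [TensorProduct.mk_apply, sw_tmul_of_linear X.oneH x (TensorProduct.rid k X.H ∘ₗ
      (Coalgebra.counit (R := k)).lTensor X.H) fun a b => by simp]
  comul_mul x y := by
    simp only [TensorProduct.mk_apply, h.isBijRelRB.sw_trivial_coact]
    exact h.hopfK.choose_spec.comul_mul x y
  comul_one := h.hopfK.choose_spec.comul_one
  counit_mul := h.hopfK.choose_spec.counit_mul
  counit_one := h.hopfK.choose_spec.counit_one

theorem isYDRelRB_trivObj : IsYDRelRB (trivObj X) where
  hopf := h.hopfH
  bimonoid := h.trivial_isYDBimonoid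
  rotaBaxter := h.rotaBaxter
  symmetric := by
    have := h.cocommK
    exact h.isBijRelRB.symmetric_of_isCocomm
  bijective := h.bijective
  inverse := h.isBijRelRB.inverse_of_antipode h.hopfK.choose_spec.toIsAntipode

end IsCocommBijRB

/-- In the cocommutative case the coaction prescribed on objects of `D` is the trivial one. -/
theorem IsBijRelRB.adjoint_coact_of_isCocomm {X : RelData.{u, v} k} (h : IsBijRelRB X)
    [Coalgebra.IsCocomm k X.H] : (X.Rinv h.bijective).lTensor X.H ∘ₗ adL X.mulH X.SH ∘ₗ
      (X.R : X.K →ₗ[k] X.H) = TensorProduct.mk k X.H X.K X.oneH := by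
  refine LinearMap.ext fun x => ?_
  simp only [LinearMap.comp_apply, h.hopf.adL_of_isCocomm, LinearMap.lTensor_tmul,
    CoalgHom.coe_toLinearMap, X.Rinv_R, TensorProduct.mk_apply]

theorem IsCocommBijRB.isD_trivObj {X : RelData.{u, v} k} (h : IsCocommBijRB X) :
    isD k ⟨trivObj X, h.isYDRelRB_trivObj⟩ := by
  have := h.cocommH
  exact h.isBijRelRB.adjoint_coact_of_isCocomm.symm

theorem RelData.isCocomm_K (X : RelData.{u, v} k) (hR : Function.Bijective X.R)
    [Coalgebra.IsCocomm k X.H] : Coalgebra.IsCocomm k X.K where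
  comm_comp_comul := by
    refine LinearMap.ext fun b => ?_
    obtain ⟨x, rfl⟩ : ∃ x, X.Rinv hR x = b := ⟨X.R b, X.Rinv_R _ b⟩
    rw [LinearMap.comp_apply, X.comul_Rinv, LinearEquiv.coe_coe, ← TensorProduct.map_comm,
      Coalgebra.comm_comul]

namespace IsYDRelRB

variable {X : RBData.{u, v} k} (h : IsYDRelRB X)
include h

theorem eq_trivObj (hD : isD k ⟨X, h⟩) [Coalgebra.IsCocomm k X.H] :
    X = trivObj X.toRelData := by
  have e : X.coact = TensorProduct.mk k X.H X.K X.oneH :=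
    hD.trans h.isBijRelRB.adjoint_coact_of_isCocomm
  exact congrArg (RBData.mk X.toRelData) e

theorem isCocommBijRB (hD : isD k ⟨X, h⟩) (hc : Coalgebra.IsCocomm k X.H) :
    IsCocommBijRB X.toRelData where
  hopfH := h.hopf
  cocommH := hc
  hopfK := ⟨_, {
    toIsAlg := h.bimonoid.toIsAlg
    toIsAntipode := h.isBijRelRB.isAntipode_convAct h.inverse
    comul_mul := fun x y => by
      have e₀ : X.coact = TensorProduct.mk k X.H X.K X.oneH :=
        hD.trans h.isBijRelRB.adjoint_coact_of_isCocomm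
      rw [h.bimonoid.comul_mul]
      simp only [e₀, TensorProduct.mk_apply, h.isBijRelRB.sw_trivial_coact]
    comul_one := h.bimonoid.comul_one
    counit_mul := h.bimonoid.counit_mul
    counit_one := h.bimonoid.counit_one }⟩
  cocommK := X.isCocomm_K h.bijective
  moduleBialgebra := h.bimonoid.toIsModuleAlgCoalg
  rotaBaxter := h.rotaBaxter
  bijective := h.bijective

end IsYDRelRB

/-! ### The equivalences of categories -/

section Categories

/-- The morphism `A → M L A` and its inverse are the identity on the underlying coalgebra. -/
noncomputable def transportIdIso (A : PHData.{u, v} k) (hR : Function.Bijective (idObj A).R) :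
    A ≅ transportObj (idObj A).toRelData hR :=
  have e : ∀ a : A.H, (idObj A).Rinv hR a = a := (idObj A).R_Rinv hR
  have hm : ∀ x y : A.H, A.mul x y = A.mul ((idObj A).Rinv hR x) ((idObj A).Rinv hR y) :=
    fun x y => (congrArg₂ (fun a b => A.mul a b) (e x) (e y)).symm
  have ha : ∀ x y : A.H, A.act x y = A.act x ((idObj A).Rinv hR y) :=
    fun x y => (congrArg (A.act x) (e y)).symm
  { hom := (⟨CoalgHom.id k A.H, hm, rfl, ha⟩ :
      PHData.Hom A (transportObj (idObj A).toRelData hR))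
    inv := (⟨CoalgHom.id k A.H, fun x y => (hm x y).symm, rfl, fun x y => (ha x y).symm⟩ :
      PHData.Hom (transportObj (idObj A).toRelData hR) A)
    hom_inv_id := rfl
    inv_hom_id := rfl }

/-- The pair `(id, R⁻¹)` from `L M R` to `R`. -/
noncomputable def idTransportIso {X : RelData.{u, v} k} (h : IsBijRelRB X) :
    (idObj (transportObj X h.bijective)).toRelData ≅ X where
  hom := (⟨CoalgHom.id k X.H, X.RinvHom h.bijective, h.transport_bullet, rfl,
    fun _ _ => X.Rinv_R h.bijective _, h.Rinv_one, fun x => (X.R_Rinv h.bijective x).symm,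
    fun _ _ => X.Rinv_R h.bijective _⟩ :
      RelData.Hom (idObj (transportObj X h.bijective)).toRelData X)
  inv := (⟨CoalgHom.id k X.H, X.R, fun x y => (h.transport_bullet x y).symm, rfl,
    fun x y => congrArg X.R (congrArg₂ (fun a b => X.mulK a b) (X.Rinv_R h.bijective x).symm
      (X.Rinv_R h.bijective y).symm), h.R_one, fun _ => rfl,
    fun a x => congrArg X.R (congrArg (X.act a) (X.Rinv_R h.bijective x).symm)⟩ :
      RelData.Hom X (idObj (transportObj X h.bijective)).toRelData)
  hom_inv_id := RelData.Hom.ext rfl (DFunLike.ext _ _ fun x => X.R_Rinv h.bijective x)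
  inv_hom_id := RelData.Hom.ext rfl (DFunLike.ext _ _ fun x => X.Rinv_R h.bijective x)

variable (k) in
/-- Forgetting the coaction. -/
def forgetCoact : RBData.{u, v} k ⥤ RelData.{u, v} k where
  obj X := X.toRelData
  map p := p

/-- Morphisms of operators do not refer to the coactions. -/
def isoOfRelData {X Y : RBData.{u, v} k} (e : X.toRelData ≅ Y.toRelData) : X ≅ Y where
  hom := e.hom
  inv := e.inv
  hom_inv_id := e.hom_inv_id
  inv_hom_id := e.inv_hom_id

variable (k)

theorem isYDRelRB_idObj (A : YDPostHopf.{u, v} k) : IsYDRelRB (idObj A.obj) :=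
  A.property.isYDRelRB_idObj

theorem isD_idObj (A : YDPostHopf.{u, v} k) : isD k ⟨idObj A.obj, isYDRelRB_idObj k A⟩ :=
  A.property.isD_idObj

theorem isYDPostHopf_transportObj (X : CatD.{u, v} k) :
    IsYDPostHopf (transportObj X.obj.obj.toRelData X.obj.property.bijective) :=
  X.obj.property.transport_isYDPostHopf X.property

/-- The functors `L` and `M` form an equivalence. -/
noncomputable def equivLM : YDPostHopf.{u, v} k ≌ CatD.{u, v} k :=
  CategoryTheory.Equivalence.mk (functorL (isYDRelRB_idObj k) (isD_idObj k))
    (functorM (isYDPostHopf_transportObj k))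
    (NatIso.ofComponents (fun A => ObjectProperty.isoMk _
      (transportIdIso A.obj (isYDRelRB_idObj k A).bijective)) fun _ => rfl)
    (NatIso.ofComponents (fun X => ObjectProperty.isoMk _ (ObjectProperty.isoMk _
      (isoOfRelData (idTransportIso X.obj.property.isBijRelRB)))) fun {X Y} p =>
        ObjectProperty.hom_ext _ (ObjectProperty.hom_ext _ (RelData.Hom.ext rfl
          (DFunLike.ext _ _ fun x => (RelData.Hom.map_Rinv p.hom.hom X.obj.property.bijective
            Y.obj.property.bijective x).symm))))

theorem isYDRelRB_trivObj (X : CocommBijRB.{u, v} k) : IsYDRelRB (trivObj X.obj) :=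
  X.property.isYDRelRB_trivObj

theorem isD_trivObj (X : CocommBijRB.{u, v} k) :
    isD k ⟨trivObj X.obj, isYDRelRB_trivObj k X⟩ :=
  X.property.isD_trivObj

theorem isCocommBijRB_idObj (A : CocommPostHopf.{u, v} k) :
    IsCocommBijRB (idObj A.obj).toRelData :=
  A.property.isYDPostHopf.isYDRelRB_idObj.isCocommBijRB A.property.isYDPostHopf.isD_idObj
    A.property.cocomm

theorem isCocommPostHopf_transportObj (X : CocommBijRB.{u, v} k) :
    IsCocommPostHopf (transportObj X.obj X.property.bijective) :=
  (X.property.isYDRelRB_trivObj.transport_isYDPostHopf X.property.isD_trivObj).isCocommPostHopf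
    X.property.cocommH

/-- The restriction of `L` and `M` to cocommutative objects. -/
noncomputable def cocommEquiv : CocommPostHopf.{u, v} k ≌ CocommBijRB.{u, v} k :=
  CategoryTheory.Equivalence.mk
    ((isCocommBijRB k).lift ((isCocommPostHopf k).ι ⋙ idFunctor k ⋙ forgetCoact k)
      (isCocommBijRB_idObj k))
    ((isCocommPostHopf k).lift (inclRB (isYDRelRB_trivObj k) (isD_trivObj k) ⋙ (isD k).ι ⋙
      transportFunctor k) (isCocommPostHopf_transportObj k))
    (NatIso.ofComponents (fun A => ObjectProperty.isoMk _
      (transportIdIso A.obj (isCocommBijRB_idObj k A).bijective)) fun _ => rfl)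
    (NatIso.ofComponents (fun X => ObjectProperty.isoMk _
      (idTransportIso X.property.isBijRelRB)) fun {X Y} p =>
        ObjectProperty.hom_ext _ (RelData.Hom.ext rfl
          (DFunLike.ext _ _ fun x => (RelData.Hom.map_Rinv p.hom X.property.bijective
            Y.property.bijective x).symm)))

end Categories
end TrivialCoaction
end YDPH

theorem mainTheorem2 (k : Type u) [Field k] :
    -- the functors `L` and `M` are well defined
    ∃ (hL : ∀ A : YDPH.YDPostHopf.{u, v} k, YDPH.IsYDRelRB (YDPH.idObj A.obj))
      (hLD : ∀ A : YDPH.YDPostHopf.{u, v} k, YDPH.isD k ⟨YDPH.idObj A.obj, hL A⟩)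
      (hM : ∀ X : YDPH.CatD.{u, v} k, YDPH.IsYDPostHopf
        (YDPH.transportObj X.obj.obj.toRelData X.obj.property.bijective)),
      -- they are mutually quasi-inverse equivalences
      (∃ e : YDPH.YDPostHopf.{u, v} k ≌ YDPH.CatD.{u, v} k,
        e.functor = YDPH.functorL hL hLD ∧ e.inverse = YDPH.functorM hM) ∧
      -- cocommutative post-Hopf algebras are the cocommutative YD post-Hopf algebras
      (∀ A : YDPH.PHData.{u, v} k, YDPH.IsCocommPostHopf A ↔
        YDPH.IsYDPostHopf A ∧ Coalgebra.IsCocomm k A.H) ∧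
      -- bijective relative Rota-Baxter operators on cocommutative Hopf algebras are the objects
      -- `R : K → H` of `D` with `H` cocommutative; the coaction of such an object is trivial
      (∀ X : YDPH.RBData.{u, v} k,
        (YDPH.IsCocommBijRB X.toRelData ∧ X = YDPH.trivObj X.toRelData) ↔
          (∃ h : YDPH.IsYDRelRB X, YDPH.isD k ⟨X, h⟩) ∧ Coalgebra.IsCocomm k X.H) ∧
      -- the equivalence restricts to an equivalence between these two categories
      ∃ (hI : ∀ A : YDPH.PHData.{u, v} k, YDPH.IsCocommPostHopf A → YDPH.IsYDPostHopf A)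
        (hJ : ∀ X : YDPH.CocommBijRB.{u, v} k, YDPH.IsYDRelRB (YDPH.trivObj X.obj))
        (hJD : ∀ X : YDPH.CocommBijRB.{u, v} k, YDPH.isD k ⟨YDPH.trivObj X.obj, hJ X⟩)
        (e' : YDPH.CocommPostHopf.{u, v} k ≌ YDPH.CocommBijRB.{u, v} k),
        Nonempty (e'.functor ⋙ YDPH.inclRB hJ hJD ≅
          YDPH.inclPH hI ⋙ YDPH.functorL hL hLD) ∧
        Nonempty (e'.inverse ⋙ YDPH.inclPH hI ≅
          YDPH.inclRB hJ hJD ⋙ YDPH.functorM hM) := by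
  refine ⟨YDPH.isYDRelRB_idObj k, YDPH.isD_idObj k, YDPH.isYDPostHopf_transportObj k,
    ⟨YDPH.equivLM k, rfl, rfl⟩, fun A => ⟨fun h => ⟨h.isYDPostHopf, h.cocomm⟩,
      fun h => h.1.isCocommPostHopf h.2⟩, fun X => ⟨?_, ?_⟩, fun A h => h.isYDPostHopf,
    YDPH.isYDRelRB_trivObj k, YDPH.isD_trivObj k, YDPH.cocommEquiv k, ⟨?_⟩, ⟨?_⟩⟩
  · rintro ⟨h, hX⟩
    rw [hX]
    exact ⟨⟨h.isYDRelRB_trivObj, h.isD_trivObj⟩, h.cocommH⟩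
  · rintro ⟨⟨h, hD⟩, hc⟩
    exact ⟨h.isCocommBijRB hD hc, h.eq_trivObj hD⟩
  · exact NatIso.ofComponents (fun A => ObjectProperty.isoMk _ (ObjectProperty.isoMk _
      (YDPH.isoOfRelData (Iso.refl (YDPH.idObj A.obj).toRelData)))) fun _ => rfl
  · exact NatIso.ofComponents (fun X => ObjectProperty.isoMk _
      (Iso.refl (YDPH.transportObj X.obj X.property.bijective))) fun _ => rfl
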